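/- Let $m\ge 0$ be a fixed integer, $0<\theta_1<\dots<\theta_m<1$ fixed proportions, $\mu_1,\dots,\mu_{m+1}\in\mathbb{R}$ with $\mu_k\ne\mu_{k+1}$ for $1\le k\le m$, and $\sigma^2>0$. For each $n$ let $\tau_k=\tau_k(n)=\lfloor\theta_k n\rfloor$, $\tau_0=0$, $\tau_{m+1}=n$, and observe $Y_i=\mu_k+\epsilon_i$ for $\tau_{k-1}<i\le\tau_k$, $1\le k\le m+1$, where $\epsilon_1,\dots,\epsilon_n$ are i.i.d. $N(0,\sigma^2)$. For $a\le b$, a candidate set $\mathcal{B}$ and a penalty $\beta$, let $\mathrm{PELT}(y_{a:b},\mathcal{B})$ be a set $\{t_1<\dots<t_k\}\subseteq\mathcal{B}\cap\{a,\dots,b-1\}$ (of any size $k\ge 0$) that minimises $$\sum_{i=1}^{k+1}\bigl[\mathcal{C}(y_{t_{i-1}+1:t_i})+\beta\bigr],\qquad t_0=a-1,\ t_{k+1}=b,\qquad \mathcal{C}(y_{s:t})=\sum_{i=s}^t\Bigl(y_i-\tfrac1{t-s+1}\sum_{j=s}^t y_j\Bigr)^2 .$$ The Chunk procedure with $L(n)$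 cores and overlap $V(n)$ forms the blocks $\mathcal{B}_i=\{(i-1)\lfloor n/L(n)\rfloor-V(n),\dots,i\lfloor n/L(n)\rfloor+V(n)\}\cap\{1,\dots,n\}$ for $1\le i\le L(n)$, except that the last block extends to $n$; computes $\hat{\boldsymbol\tau}_i=\mathrm{PELT}(Y_{\mathcal{B}_i},\mathcal{B}_i)$ for every $i$; and returns $\{\hat\tau_1<\dots<\hat\tau_{\hat m}\}=\mathrm{PELT}\bigl(Y_{1:n},\bigcup_{i}\hat{\boldsymbol\tau}_i\bigr)$. All runs use the penalty $\beta=(2+\epsilon)\sigma^2\log n$ with a fixed $\epsilon>0$, that is, $\beta=(2+\epsilon)\log n$ for noise of unit variance. Suppose that $L(n)\to\infty$ and $L(n)=o(n)$, that $V(n)=o(n)$, and that for some $\gamma>0$, $V(n)\ge\lceil(\log n)^{1+\gamma}\rceil$ for all large $n$. Then for every $\alpha>0$, $$\mathbb{P}\Bigl(\hat m=m\ \text{ and }\ \max_{1\le i\le m}|\hat\tau_i-\tau_i|\le\bigl\lceil(\log n)^{1+\alpha}\bigr\rceil\Bigr)\to 1\qquad(n\to\infty),$$ however ties between minimisers are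 broken. -/

import Mathlib

open MeasureTheory ProbabilityTheory Filter Asymptotics
open scoped Topology NNReal

namespace Changepoint

/-- Quadratic error loss of the segment `y_s, …, y_t`. -/
noncomputable def segCost (y : ℕ → ℝ) (s t : ℕ) : ℝ :=
  ∑ i ∈ Finset.Icc s t, (y i - (1 / ((t : ℝ) - s + 1)) * ∑ j ∈ Finset.Icc s t, y j) ^ 2

/-- First index of the segment that ends at `r`, when the data `y_a, y_{a+1}, …` are segmented by
the changepoints in `S` (a changepoint is the last index of its segment): one more than the
largest changepoint below `r`, or `a` if there is none. -/
def segStart (a : ℕ) (S : Finset ℕ) (r : ℕ) : ℕ :=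
  max a ((S.filter (· < r)).sup (· + 1))

/-- Penalised cost of segmenting `y_a, …, y_b` at the changepoints `S ⊆ {a, …, b - 1}`: every
segment, indexed by its right end `r ∈ S ∪ {b}`, contributes its loss plus `β`. -/
noncomputable def penCost (y : ℕ → ℝ) (β : ℝ) (a b : ℕ) (S : Finset ℕ) : ℝ :=
  ∑ r ∈ insert b S, (segCost y (segStart a S r) r + β)

/-- `S` is a possible result of `PELT (y_{a:b}, B)`: it exactly minimises the penalised cost of
`y_a, …, y_b` among all sets of changepoints taken from `B`. A changepoint splits the data into
two nonempty parts, so only candidates in `{a, …, b - 1}` can be used. -/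
def IsPELT (y : ℕ → ℝ) (β : ℝ) (a b : ℕ) (B S : Finset ℕ) : Prop :=
  S ⊆ B ∩ Finset.Ico a b ∧ ∀ S' ⊆ B ∩ Finset.Ico a b, penCost y β a b S ≤ penCost y β a b S'

/-- First index of the `i`-th block, `i = 1, …, L`, of `{1, …, n}` with overlap `V`. -/
def blockLo (n L V i : ℕ) : ℕ := max 1 ((i - 1) * (n / L) - V)

/-- Last index of the `i`-th block, `i = 1, …, L`, of `{1, …, n}` with overlap `V`. -/
def blockHi (n L V i : ℕ) : ℕ := if i = L then n else min n (i * (n / L) + V)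

/-- `S` is a possible result of the Chunk procedure with `L` cores, overlap `V` and penalty `β`
on the data `y_1, …, y_n`: the `i`-th core returns a result `T i` of PELT on the `i`-th block,
and `S` is a result of PELT on all the data with candidates `⋃ i, T i`. -/
def IsChunk (y : ℕ → ℝ) (β : ℝ) (n L V : ℕ) (S : Finset ℕ) : Prop :=
  ∃ T : ℕ → Finset ℕ,
    (∀ i ∈ Finset.Icc 1 L,
      IsPELT y β (blockLo n L V i) (blockHi n L V i)
        (Finset.Icc (blockLo n L V i) (blockHi n L V i)) (T i)) ∧
    IsPELT y β 1 n ((Finset.Icc 1 L).biUnion T) S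

/-- True changepoints `τ_j = ⌊θ_j n⌋` in a series of length `n`. -/
noncomputable def trueChange {m : ℕ} (θ : Fin m → ℝ) (n : ℕ) (j : Fin m) : ℕ := ⌊θ j * n⌋₊

/-- Mean of the `i`-th observation in a series of length `n`: it is the mean of the segment whose
(zero-based) number is the number of true changepoints before `i`. -/
noncomputable def signal {m : ℕ} (θ : Fin m → ℝ) (μ : Fin (m + 1) → ℝ) (n i : ℕ) : ℝ :=
  μ ⟨(Finset.univ.filter fun j : Fin m => trueChange θ n j < i).card,
    Nat.lt_succ_of_le ((Finset.card_le_univ _).trans_eq (Fintype.card_fin m))⟩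

/-- `S` has exactly `m` elements `τ̂_1 < … < τ̂_m`, and `|τ̂_j - τ_j| ≤ r` for all `j`. -/
def Recovers {m : ℕ} (τ : Fin m → ℕ) (r : ℕ) (S : Finset ℕ) : Prop :=
  ∃ h : S.card = m, ∀ j : Fin m, |((S.orderEmbOfFin h j : ℕ) : ℝ) - (τ j : ℝ)| ≤ (r : ℝ)

/-- PELT always has a result. -/
theorem exists_isPELT (y : ℕ → ℝ) (β : ℝ) (a b : ℕ) (B : Finset ℕ) :
    ∃ S, IsPELT y β a b B S := by
  obtain ⟨S, hS, hmin⟩ := Finset.exists_min_image (B ∩ Finset.Ico a b).powerset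
    (penCost y β a b) ⟨∅, Finset.empty_mem_powerset _⟩
  exact ⟨S, Finset.mem_powerset.1 hS, fun S' hS' => hmin S' (Finset.mem_powerset.2 hS')⟩

/-- The Chunk procedure always has a result. -/
theorem exists_isChunk (y : ℕ → ℝ) (β : ℝ) (n L V : ℕ) : ∃ S, IsChunk y β n L V S := by
  choose T hT using fun i : ℕ => exists_isPELT y β (blockLo n L V i) (blockHi n L V i)
    (Finset.Icc (blockLo n L V i) (blockHi n L V i))
  obtain ⟨S, hS⟩ := exists_isPELT y β 1 n ((Finset.Icc 1 L).biUnion T)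
  exact ⟨S, T, fun i _ => hT i, hS⟩

end Changepoint

/-!
# Consistency of the Chunk procedure for parallel changepoint detection

Write `l = σ² log n`, so that the penalty is `(2 + ε) l`, and call `E² / (y - x)` the normalised
square of the noise sum `E` over `(x, y]`.

**Noise.** With probability tending to one, all normalised squares are at most `(2 + ε / 2) l`, and
those whose left end lies in a set `A` of polylogarithmic size are at most `δ l`, for any fixed
`δ > 0` (`tendsto_measure_exists_lt_sq_sum`). A union bound over all pairs `(x, y)` only gives the
constant `4`. Instead the union runs over all left ends, but only over a geometric grid of lengths,
which has `O(log n)` elements; the rest of the sum is short compared with the length and is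
controlled by the crude bound.

**Costs.** The penalised cost is a least-squares problem over piecewise constant functions
(`exists_constOff_penCost_eq`, `penCost_le_of_constOff`). Cutting at the changepoints of `S` and at
the true ones, one finds that the cost of `S` falls below the noise energy `∑ e_i²` by at most one
normalised square per piece, charged to the left end of the piece (`noise_sub_le_penCost`); the
bound improves by a multiple of `d` if `S` has no changepoint within `d` of a true one
(`noise_sub_add_jump_le_penCost`). Conversely, competitors with changepoints close to the true ones
cost hardly more than the noise energy (`penCost_le_noise_add`).

**Conclusion.** Let `A` consist of `0`, the left ends of the blocks of interest, and all points
within `r ≈ (log n) ^ (1 + κ)` of true changepoints, with `κ < min α γ`. The overlap exceeds `r`, so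
each true changepoint is far from the ends of some block and is the only one in it. That block
returns a candidate within `r` of it, and hence, since this one starts only small noise sums, also
one within `ρ = δ' l` (`IsPELT.exists_near`). Spurious candidates do no harm: in the final run the
candidates close to the true changepoints form a competitor whose excess cost is a small multiple
of `l`. The optimal `S` therefore meets every window of radius `r`, and a changepoint in excess of
`m` would cost at least `(ε / 2) l` more than it could save (`IsPELT.recovers`).
-/

namespace Changepoint

/-! ### Penalised cost as a least-squares problem over piecewise constant functions -/

/-- `g` is constant on each of the segments into which the changepoints in `S` cut `{a, …, b}`;
as everywhere in this file, a changepoint is the last index of its segment. -/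
def ConstOff (S : Finset ℕ) (a b : ℕ) (g : ℕ → ℝ) : Prop :=
  ∀ i j, a ≤ i → i ≤ j → j ≤ b → (∀ s ∈ S, s < i ∨ j ≤ s) → g i = g j

lemma segCost_le (y : ℕ → ℝ) {a b : ℕ} (hab : a ≤ b) (c : ℝ) :
    segCost y a b ≤ ∑ i ∈ Finset.Icc a b, (y i - c) ^ 2 := by
  unfold segCost
  set N : ℝ := (b : ℝ) - a + 1 with hN
  set Y := ∑ j ∈ Finset.Icc a b, y j with hY
  have hcard : ((Finset.Icc a b).card : ℝ) = N := by
    rw [Nat.card_Icc, Nat.cast_sub (by omega)]; push_cast; ring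
  have hNpos : 0 < N := by
    have : (a : ℝ) ≤ b := by exact_mod_cast hab
    linarith
  have expand : ∀ t : ℝ, ∑ i ∈ Finset.Icc a b, (y i - t) ^ 2
      = ∑ i ∈ Finset.Icc a b, y i ^ 2 - 2 * t * Y + N * t ^ 2 := by
    intro t
    have : ∀ i ∈ Finset.Icc a b, (y i - t) ^ 2 = y i ^ 2 - 2 * t * y i + t ^ 2 :=
      fun i _ => by ring
    rw [Finset.sum_congr rfl this, Finset.sum_add_distrib, Finset.sum_sub_distrib,
      ← Finset.mul_sum, Finset.sum_const, nsmul_eq_mul, hcard]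
  rw [expand, expand]
  have : N * (c - Y / N) ^ 2 = N * c ^ 2 - 2 * c * Y + Y ^ 2 / N := by
    field_simp
    ring
  have h2 : 0 ≤ N * (c - Y / N) ^ 2 := by positivity
  have h3 : 2 * (1 / N * Y) * Y = 2 * (Y ^ 2 / N) := by ring
  have h4 : N * (1 / N * Y) ^ 2 = Y ^ 2 / N := by field_simp
  linarith

lemma penCost_empty (y : ℕ → ℝ) (β : ℝ) (a b : ℕ) :
    penCost y β a b ∅ = segCost y a b + β := by
  simp [penCost, segStart]

/-- Splitting off the last segment. -/
lemma penCost_insert_max (y : ℕ → ℝ) (β : ℝ) {a b u : ℕ} {S : Finset ℕ}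
    (hS : ∀ s ∈ S, s < u) (hau : a ≤ u) (hub : u < b) :
    penCost y β a b (insert u S) = penCost y β a u S + (segCost y (u + 1) b + β) := by
  have hb : b ∉ insert u S := by
    simp only [Finset.mem_insert, not_or]
    exact ⟨by omega, fun h => by have := hS b h; omega⟩
  have h1 : segStart a (insert u S) b = u + 1 := by
    unfold segStart
    have : (insert u S).filter (· < b) = insert u S := by
      apply Finset.filter_true_of_mem
      intro x hx
      rcases Finset.mem_insert.1 hx with rfl | hx
      · exact hub
      · have := hS x hx; omega
    rw [this, Finset.sup_insert]
    have h2 : S.sup (· + 1) ≤ u + 1 := Finset.sup_le fun s hs => by have := hS s hs; omega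
    have h3 : (u + 1) ⊔ S.sup (· + 1) = u + 1 := sup_eq_left.2 h2
    rw [h3]
    exact max_eq_right (by omega)
  unfold penCost
  rw [Finset.sum_insert hb, h1, add_comm]
  congr 1
  refine Finset.sum_congr rfl fun r hr => ?_
  have hru : r ≤ u := by
    rcases Finset.mem_insert.1 hr with rfl | hr
    · exact le_rfl
    · exact (hS r hr).le
  have : segStart a (insert u S) r = segStart a S r := by
    unfold segStart
    rw [Finset.filter_insert, if_neg (by omega)]
  rw [this]

lemma sum_Icc_split (F : ℕ → ℝ) {a b u : ℕ} (hau : a ≤ u) (hub : u < b) :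
    ∑ i ∈ Finset.Icc a b, F i
      = ∑ i ∈ Finset.Icc a u, F i + ∑ i ∈ Finset.Icc (u + 1) b, F i := by
  rw [← Finset.sum_union]
  · congr 1
    ext i
    simp only [Finset.mem_union, Finset.mem_Icc]
    omega
  · rw [Finset.disjoint_left]
    intro i
    simp only [Finset.mem_Icc]
    omega

/-- The fit by segment means attains the penalised cost. -/
lemma exists_constOff_penCost_eq (y : ℕ → ℝ) (β : ℝ) {a b : ℕ} {S : Finset ℕ}
    (hS : S ⊆ Finset.Ico a b) :
    ∃ g, ConstOff S a b g ∧
      penCost y β a b S = ∑ i ∈ Finset.Icc a b, (y i - g i) ^ 2 + (S.card + 1) * β := by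
  induction S using Finset.induction_on_max generalizing b with
  | empty =>
    refine ⟨fun _ => 1 / ((b : ℝ) - a + 1) * ∑ j ∈ Finset.Icc a b, y j, fun _ _ _ _ _ _ => rfl, ?_⟩
    rw [penCost_empty]
    simp [segCost]
  | insert u S hmax ih =>
    have hu : a ≤ u ∧ u < b := Finset.mem_Ico.1 (hS (Finset.mem_insert_self _ _))
    obtain ⟨g, hg, hcost⟩ := ih (b := u) fun s hs => Finset.mem_Ico.2
      ⟨(Finset.mem_Ico.1 (hS (Finset.mem_insert_of_mem hs))).1, hmax s hs⟩
    set c : ℝ := 1 / ((b : ℝ) - (u + 1 : ℕ) + 1) * ∑ j ∈ Finset.Icc (u + 1) b, y j with hc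
    refine ⟨fun i => if i ≤ u then g i else c, ?_, ?_⟩
    · intro i j hi hij hj hs
      rcases hs u (Finset.mem_insert_self _ _) with h | h
      · have h1 : ¬ i ≤ u := by omega
        have h2 : ¬ j ≤ u := by omega
        simp [h1, h2]
      · have h1 : i ≤ u := by omega
        simp only [h1, h, if_true]
        exact hg i j hi hij h fun s hs' => hs s (Finset.mem_insert_of_mem hs')
    · rw [penCost_insert_max y β hmax hu.1 hu.2, hcost, sum_Icc_split _ hu.1 hu.2,
        Finset.card_insert_of_notMem fun h => (hmax u h).false]
      have h1 : ∑ i ∈ Finset.Icc a u, (y i - if i ≤ u then g i else c) ^ 2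
          = ∑ i ∈ Finset.Icc a u, (y i - g i) ^ 2 :=
        Finset.sum_congr rfl fun i hi => by rw [if_pos (Finset.mem_Icc.1 hi).2]
      have h2 : ∑ i ∈ Finset.Icc (u + 1) b, (y i - if i ≤ u then g i else c) ^ 2
          = segCost y (u + 1) b :=
        Finset.sum_congr rfl fun i hi => by
          have := (Finset.mem_Icc.1 hi).1
          rw [if_neg (by omega), hc]
      rw [h1, h2]
      push_cast
      ring

/-- Every piecewise constant fit costs at least the penalised cost. -/
lemma penCost_le_of_constOff (y : ℕ → ℝ) (β : ℝ) {a b : ℕ} (hab : a ≤ b) {S : Finset ℕ}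
    (hS : S ⊆ Finset.Ico a b) {g : ℕ → ℝ} (hg : ConstOff S a b g) :
    penCost y β a b S ≤ ∑ i ∈ Finset.Icc a b, (y i - g i) ^ 2 + (S.card + 1) * β := by
  induction S using Finset.induction_on_max generalizing b with
  | empty =>
    rw [penCost_empty]
    have := segCost_le y hab (g b)
    have h1 : ∑ i ∈ Finset.Icc a b, (y i - g i) ^ 2 = ∑ i ∈ Finset.Icc a b, (y i - g b) ^ 2 :=
      Finset.sum_congr rfl fun i hi => by
        rw [hg i b (Finset.mem_Icc.1 hi).1 (Finset.mem_Icc.1 hi).2 le_rfl (by simp)]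
    rw [h1]
    simpa using this
  | insert u S hmax ih =>
    have hu : a ≤ u ∧ u < b := Finset.mem_Ico.1 (hS (Finset.mem_insert_self _ _))
    have h1 := ih (b := u) hu.1 (fun s hs => Finset.mem_Ico.2
      ⟨(Finset.mem_Ico.1 (hS (Finset.mem_insert_of_mem hs))).1, hmax s hs⟩)
      (fun i j hi hij hj hs => hg i j hi hij (by omega) fun s hs' => by
        rcases Finset.mem_insert.1 hs' with rfl | h
        · exact Or.inr hj
        · exact hs s h)
    have h2 := segCost_le y (show u + 1 ≤ b by omega) (g b)
    have h3 : ∑ i ∈ Finset.Icc (u + 1) b, (y i - g i) ^ 2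
        = ∑ i ∈ Finset.Icc (u + 1) b, (y i - g b) ^ 2 :=
      Finset.sum_congr rfl fun i hi => by
        have hi := Finset.mem_Icc.1 hi
        rw [hg i b (by omega) hi.2 le_rfl]
        intro s hs
        rcases Finset.mem_insert.1 hs with rfl | h
        · exact Or.inl (by omega)
        · have := hmax s h
          exact Or.inl (by omega)
    rw [penCost_insert_max y β hmax hu.1 hu.2, sum_Icc_split _ hu.1 hu.2,
        Finset.card_insert_of_notMem fun h => (hmax u h).false, h3]
    push_cast
    linarith

/-! ### Bounds on the penalised cost in terms of the noise -/

/-- Summing a bound over the pieces `(x, y]` of `(a, b]` cut at the points of `X`; the bound is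
attached to the left end of the piece. -/
lemma sum_le_sum_Ioc_of_pieces (F G : ℕ → ℝ) {a b : ℕ} (hab : a < b) {X : Finset ℕ}
    (hX : ∀ x ∈ X, a < x ∧ x < b)
    (h : ∀ x ∈ insert a X, ∀ y ∈ insert b X, x < y → (∀ z ∈ X, z ≤ x ∨ y ≤ z) →
      G x ≤ ∑ i ∈ Finset.Ioc x y, F i) :
    ∑ x ∈ insert a X, G x ≤ ∑ i ∈ Finset.Ioc a b, F i := by
  induction X using Finset.induction_on_max generalizing b with
  | empty => simpa using h a (by simp) b (by simp) hab (by simp)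
  | insert u X hmax ih =>
    have hu := hX u (Finset.mem_insert_self _ _)
    have h1 := ih (b := u) hu.1
      (fun x hx => ⟨(hX x (Finset.mem_insert_of_mem hx)).1, hmax x hx⟩)
      (fun x hx y hy hxy hz => h x
        (by simp only [Finset.mem_insert] at hx ⊢; tauto) y
        (by simp only [Finset.mem_insert] at hy ⊢; tauto) hxy fun z hz' => by
          rcases Finset.mem_insert.1 hz' with rfl | h'
          · right
            rcases Finset.mem_insert.1 hy with rfl | hy
            · exact le_rfl
            · exact (hmax y hy).le
          · exact hz z h')
    have h2 := h u (by simp) b (by simp) hu.2 fun z hz => Or.inl <| by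
      rcases Finset.mem_insert.1 hz with rfl | h'
      · exact le_rfl
      · exact (hmax z h').le
    have h3 : u ∉ insert a X := by
      simp only [Finset.mem_insert, not_or]
      exact ⟨by omega, fun h => (hmax u h).false⟩
    rw [Finset.insert_comm, Finset.sum_insert h3,
      ← Finset.sum_Ioc_consecutive F hu.1.le hu.2.le]
    linarith

/-- Excess of the squared residuals over the squared noise, on a piece on which both the signal
`f` and the fit `g` are constant. -/
lemma sum_residual_sub_noise (f g e : ℕ → ℝ) {x y i₀ : ℕ} (hxy : x < y)
    (hf : ∀ i ∈ Finset.Ioc x y, f i = f i₀) (hg : ∀ i ∈ Finset.Ioc x y, g i = g i₀) :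
    ∑ i ∈ Finset.Ioc x y, ((f i + e i - g i) ^ 2 - e i ^ 2)
      = ((y : ℝ) - x) * (f i₀ - g i₀) ^ 2 + 2 * (f i₀ - g i₀) * ∑ i ∈ Finset.Ioc x y, e i := by
  have : ∀ i ∈ Finset.Ioc x y, (f i + e i - g i) ^ 2 - e i ^ 2
      = (f i₀ - g i₀) ^ 2 + 2 * (f i₀ - g i₀) * e i := fun i hi => by
    rw [hf i hi, hg i hi]; ring
  rw [Finset.sum_congr rfl this, Finset.sum_add_distrib, ← Finset.mul_sum, Finset.sum_const,
    Nat.card_Ioc, nsmul_eq_mul, Nat.cast_sub hxy.le]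

lemma neg_le_of_sq_le {L h E w : ℝ} (hL : 0 < L) (hE : E ^ 2 ≤ w * L) :
    -w ≤ L * h ^ 2 + 2 * h * E := by
  have : 0 ≤ L * (L * h ^ 2 + 2 * h * E + w) := by nlinarith [sq_nonneg (L * h + E)]
  have := nonneg_of_mul_nonneg_right this hL
  linarith

lemma half_sub_le_of_sq_le {L h E w : ℝ} (hL : 0 < L) (hE : E ^ 2 ≤ w * L) :
    L * h ^ 2 / 2 - 2 * w ≤ L * h ^ 2 + 2 * h * E := by
  have : 0 ≤ L * (L * h ^ 2 / 2 + 2 * h * E + 2 * w) := by nlinarith [sq_nonneg (L * h / 2 + E)]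
  have := nonneg_of_mul_nonneg_right this hL
  linarith

lemma le_two_mul_add_of_sq_le {L h E w : ℝ} (hL : 0 < L) (hE : E ^ 2 ≤ w * L) :
    L * h ^ 2 + 2 * h * E ≤ 2 * (L * h ^ 2) + w := by
  have : 0 ≤ L * (L * h ^ 2 - 2 * h * E + w) := by nlinarith [sq_nonneg (L * h - E)]
  have := nonneg_of_mul_nonneg_right this hL
  linarith

lemma ConstOff.eq_on_piece {S X : Finset ℕ} {a b : ℕ} {g : ℕ → ℝ} (hg : ConstOff S (a + 1) b g)
    (hSX : S ⊆ X) {x y : ℕ} (hx : a ≤ x) (hy : y ≤ b) (hz : ∀ z ∈ X, z ≤ x ∨ y ≤ z)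
    {i j : ℕ} (hi : i ∈ Finset.Ioc x y) (hj : j ∈ Finset.Ioc x y) : g i = g j := by
  have key : ∀ k ∈ Finset.Ioc x y, g k = g y := fun k hk => by
    have hk := Finset.mem_Ioc.1 hk
    refine hg k y (by omega) hk.2 hy fun s hs => ?_
    rcases hz s (hSX hs) with h | h
    · exact Or.inl (by omega)
    · exact Or.inr h
  rw [key i hi, key j hj]

/-- If `w x` bounds the normalised square of every noise sum that starts after `x`, the penalised
cost falls short of the noise energy by at most one `w x` per segment of the common refinement of
`S` and the true changepoints `Q`. -/
lemma noise_sub_le_penCost {f e w : ℕ → ℝ} {a b : ℕ} (hab : a < b) {S Q : Finset ℕ} (β : ℝ)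
    (hS : S ⊆ Finset.Ico (a + 1) b) (hQ : Q ⊆ Finset.Ico (a + 1) b)
    (hf : ConstOff Q (a + 1) b f)
    (hw : ∀ x y, a ≤ x → x < y → y ≤ b →
      (∑ i ∈ Finset.Ioc x y, e i) ^ 2 ≤ w x * ((y : ℝ) - x)) :
    ∑ i ∈ Finset.Ioc a b, e i ^ 2 - ∑ x ∈ insert a (S ∪ Q), w x + (S.card + 1) * β
      ≤ penCost (fun i => f i + e i) β (a + 1) b S := by
  obtain ⟨g, hg, hcost⟩ := exists_constOff_penCost_eq (fun i => f i + e i) β hS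
  have hX : ∀ x ∈ S ∪ Q, a < x ∧ x < b := fun x hx => by
    rcases Finset.mem_union.1 hx with h | h
    · have := Finset.mem_Ico.1 (hS h); omega
    · have := Finset.mem_Ico.1 (hQ h); omega
  have key := sum_le_sum_Ioc_of_pieces (fun i => (f i + e i - g i) ^ 2 - e i ^ 2)
    (fun x => - w x) hab hX (fun x hx y hy hxy hz => by
      have hax : a ≤ x := by
        rcases Finset.mem_insert.1 hx with rfl | h
        · exact le_rfl
        · exact (hX x h).1.le
      have hyb : y ≤ b := by
        rcases Finset.mem_insert.1 hy with rfl | h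
        · exact le_rfl
        · exact (hX y h).2.le
      have hmem : y ∈ Finset.Ioc x y := Finset.mem_Ioc.2 ⟨hxy, le_rfl⟩
      rw [sum_residual_sub_noise f g e (i₀ := y) hxy
        (fun i hi => hf.eq_on_piece Finset.subset_union_right hax hyb hz hi hmem)
        (fun i hi => hg.eq_on_piece Finset.subset_union_left hax hyb hz hi hmem)]
      exact neg_le_of_sq_le (sub_pos.2 (by exact_mod_cast hxy)) (hw x y hax hxy hyb))
  rw [Finset.sum_neg_distrib, Finset.sum_sub_distrib] at key
  have hIcc : Finset.Icc (a + 1) b = Finset.Ioc a b := by ext; simp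
  rw [hcost, hIcc]
  linarith

/-- If no changepoint of `S` is within `d` of the true changepoint `τ`, the penalised cost
exceeds the bound of `noise_sub_le_penCost` by an amount of order `d` times the squared jump. -/
lemma noise_sub_add_jump_le_penCost {f e w : ℕ → ℝ} {a b : ℕ} {S Q : Finset ℕ} (β : ℝ)
    (hS : S ⊆ Finset.Ico (a + 1) b) (hQ : Q ⊆ Finset.Ico (a + 1) b)
    (hf : ConstOff Q (a + 1) b f)
    (hw : ∀ x y, a ≤ x → x < y → y ≤ b →
      (∑ i ∈ Finset.Ioc x y, e i) ^ 2 ≤ w x * ((y : ℝ) - x))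
    {τ d : ℕ} (hτ : τ ∈ Q) (hd : 0 < d) (had : a + d < τ) (hdb : τ + d < b)
    (hSd : ∀ s ∈ S, s < τ - d ∨ τ + d < s)
    (hQd : ∀ s ∈ Q, s ≠ τ → s < τ - d ∨ τ + d < s) :
    ∑ i ∈ Finset.Ioc a b, e i ^ 2 - ∑ x ∈ insert a (S ∪ Q ∪ {τ - d, τ + d}), w x
        - w (τ - d) - w τ + d * (f (τ + 1) - f τ) ^ 2 / 4 + (S.card + 1) * β
      ≤ penCost (fun i => f i + e i) β (a + 1) b S := by
  obtain ⟨g, hg, hcost⟩ := exists_constOff_penCost_eq (fun i => f i + e i) β hS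
  set X := S ∪ Q ∪ {τ - d, τ + d} with hXdef
  have hSX : S ⊆ X := Finset.subset_union_left.trans Finset.subset_union_left
  have hQX : Q ⊆ X := Finset.subset_union_right.trans Finset.subset_union_left
  have hX : ∀ x ∈ X, a < x ∧ x < b := fun x hx => by
    simp only [hXdef, Finset.mem_union, Finset.mem_insert, Finset.mem_singleton] at hx
    rcases hx with (h | h) | h | h
    · have := Finset.mem_Ico.1 (hS h); omega
    · have := Finset.mem_Ico.1 (hQ h); omega
    · omega
    · omega
  have hXτ : ∀ x ∈ X, x = τ ∨ x ≤ τ - d ∨ τ + d ≤ x := fun x hx => by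
    simp only [hXdef, Finset.mem_union, Finset.mem_insert, Finset.mem_singleton] at hx
    rcases hx with (h | h) | h | h
    · have := hSd x h; omega
    · by_cases hxτ : x = τ
      · exact Or.inl hxτ
      · have := hQd x h hxτ; omega
    · omega
    · omega
  have h1X : τ - d ∈ X := by simp [hXdef]
  have h2X : τ + d ∈ X := by simp [hXdef]
  have h3X : τ ∈ X := hQX hτ
  set h₁ := f τ - g τ with hh₁
  set h₂ := f (τ + 1) - g (τ + 1) with hh₂
  have hgτ : g τ = g (τ + 1) := hg τ (τ + 1) (by omega) (by omega) (by omega) fun s hs => by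
    have := hSd s hs; omega
  have hIcc : Finset.Icc (a + 1) b = Finset.Ioc a b := by ext; simp
  have key := sum_le_sum_Ioc_of_pieces (fun i => (f i + e i - g i) ^ 2 - e i ^ 2)
    (fun x => - w x + ((if x = τ - d then d * h₁ ^ 2 / 2 - w (τ - d) else 0)
      + (if x = τ then d * h₂ ^ 2 / 2 - w τ else 0))) (show a < b by omega) hX
    (fun x hx y hy hxy hz => by
      have hax : a ≤ x := by
        rcases Finset.mem_insert.1 hx with rfl | h
        · exact le_rfl
        · exact (hX x h).1.le
      have hyb : y ≤ b := by
        rcases Finset.mem_insert.1 hy with rfl | h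
        · exact le_rfl
        · exact (hX y h).2.le
      have hyτ : y = τ ∨ y ≤ τ - d ∨ τ + d ≤ y := by
        rcases Finset.mem_insert.1 hy with rfl | h
        · omega
        · exact hXτ y h
      have hz1 := hz _ h1X
      have hz2 := hz _ h2X
      have hz3 := hz _ h3X
      have hpos : 0 < (y : ℝ) - x := sub_pos.2 (by exact_mod_cast hxy)
      have hE := hw x y hax hxy hyb
      have hres : ∀ i₀ ∈ Finset.Ioc x y, _ := fun i₀ hi₀ =>
        sum_residual_sub_noise f g e (i₀ := i₀) hxy
        (fun i hi => hf.eq_on_piece hQX hax hyb hz hi hi₀)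
        (fun i hi => hg.eq_on_piece hSX hax hyb hz hi hi₀)
      by_cases hx1 : x = τ - d
      · -- the piece is `(τ - d, τ]`
        have hy : y = τ := by omega
        have hlen : (y : ℝ) - x = d := by
          rw [hy, hx1, Nat.cast_sub (by omega)]; ring
        rw [if_pos hx1, if_neg (by omega), hres y (Finset.mem_Ioc.2 ⟨hxy, le_rfl⟩), hy, ← hx1,
          ← hh₁]
        have := half_sub_le_of_sq_le (h := h₁) hpos hE
        rw [hlen, hy] at this
        rw [hy] at hlen
        rw [hlen]
        linarith
      · by_cases hx2 : x = τ
        · -- the piece is `(τ, τ + d]`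
          have hy : y = τ + d := by omega
          have hlen : (y : ℝ) - x = d := by
            rw [hy, hx2]; push_cast; ring
          rw [if_neg hx1, if_pos hx2, hres (τ + 1) (Finset.mem_Ioc.2 ⟨by omega, by omega⟩), ← hh₂,
            ← hx2]
          have := half_sub_le_of_sq_le (h := h₂) hpos hE
          rw [hlen] at this ⊢
          linarith
        · rw [if_neg hx1, if_neg hx2, hres y (Finset.mem_Ioc.2 ⟨hxy, le_rfl⟩)]
          have := neg_le_of_sq_le (h := f y - g y) hpos hE
          linarith)
  rw [Finset.sum_add_distrib, Finset.sum_add_distrib, Finset.sum_ite_eq', Finset.sum_ite_eq',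
    if_pos (Finset.mem_insert_of_mem h1X), if_pos (Finset.mem_insert_of_mem h3X),
    Finset.sum_neg_distrib, Finset.sum_sub_distrib] at key
  have hjump : (d : ℝ) * (f (τ + 1) - f τ) ^ 2 / 4 ≤ d * h₁ ^ 2 / 2 + d * h₂ ^ 2 / 2 := by
    have h5 : f (τ + 1) - f τ = h₂ - h₁ := by rw [hh₁, hh₂, hgτ]; ring
    rw [h5]
    have : (0 : ℝ) ≤ d * (h₁ + h₂) ^ 2 := by positivity
    nlinarith
  rw [hcost, hIcc]
  linarith

/-- Upper bound on the cost of `S₀` by means of a fit `g` that follows the signal `f` except on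
a few indices. -/
lemma penCost_le_noise_add {f e g : ℕ → ℝ} {a b : ℕ} (hab : a < b) {S₀ Q : Finset ℕ} (β : ℝ)
    (hS : S₀ ⊆ Finset.Ico (a + 1) b) (hQ : Q ⊆ Finset.Ico (a + 1) b)
    (hf : ConstOff Q (a + 1) b f) (hg : ConstOff S₀ (a + 1) b g) {w : ℝ}
    (hw : ∀ x ∈ insert a (S₀ ∪ Q), ∀ y, x < y → y ≤ b →
      (∑ i ∈ Finset.Ioc x y, e i) ^ 2 ≤ w * ((y : ℝ) - x)) :
    penCost (fun i => f i + e i) β (a + 1) b S₀ ≤ ∑ i ∈ Finset.Ioc a b, e i ^ 2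
      + (insert a (S₀ ∪ Q)).card * w + 2 * ∑ i ∈ Finset.Ioc a b, (f i - g i) ^ 2
      + (S₀.card + 1) * β := by
  have hcost := penCost_le_of_constOff (fun i => f i + e i) β (show a + 1 ≤ b by omega) hS hg
  have hX : ∀ x ∈ S₀ ∪ Q, a < x ∧ x < b := fun x hx => by
    rcases Finset.mem_union.1 hx with h | h
    · have := Finset.mem_Ico.1 (hS h); omega
    · have := Finset.mem_Ico.1 (hQ h); omega
  have key := sum_le_sum_Ioc_of_pieces
    (fun i => 2 * (f i - g i) ^ 2 - ((f i + e i - g i) ^ 2 - e i ^ 2))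
    (fun _ => - w) hab hX (fun x hx y hy hxy hz => by
      have hax : a ≤ x := by
        rcases Finset.mem_insert.1 hx with rfl | h
        · exact le_rfl
        · exact (hX x h).1.le
      have hyb : y ≤ b := by
        rcases Finset.mem_insert.1 hy with rfl | h
        · exact le_rfl
        · exact (hX y h).2.le
      have hmem : y ∈ Finset.Ioc x y := Finset.mem_Ioc.2 ⟨hxy, le_rfl⟩
      have hfy := fun i hi => hf.eq_on_piece (i := i) Finset.subset_union_right hax hyb hz hi hmem
      have hgy := fun i hi => hg.eq_on_piece (i := i) Finset.subset_union_left hax hyb hz hi hmem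
      rw [Finset.sum_sub_distrib, sum_residual_sub_noise f g e (i₀ := y) hxy hfy hgy]
      have : ∑ i ∈ Finset.Ioc x y, 2 * (f i - g i) ^ 2
          = 2 * (((y : ℝ) - x) * (f y - g y) ^ 2) := by
        rw [Finset.sum_congr rfl fun i hi => by rw [hfy i hi, hgy i hi], Finset.sum_const,
          Nat.card_Ioc, nsmul_eq_mul, Nat.cast_sub hxy.le]
        ring
      rw [this]
      have := le_two_mul_add_of_sq_le (h := f y - g y) (sub_pos.2 (by exact_mod_cast hxy))
        (hw x hx y hxy hyb)
      linarith)
  rw [Finset.sum_const, nsmul_eq_mul, Finset.sum_sub_distrib, Finset.sum_sub_distrib,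
    ← Finset.mul_sum] at key
  have hIcc : Finset.Icc (a + 1) b = Finset.Ioc a b := by ext; simp
  rw [hIcc] at hcost
  linarith

/-! ### Uniform bounds on partial sums of Gaussian noise -/

lemma hasSubgaussianMGF_of_hasLaw_gaussianReal {Ω : Type*} [MeasurableSpace Ω] {P : Measure Ω}
    {X : Ω → ℝ} {v : ℝ≥0} (h : HasLaw X (gaussianReal 0 v) P) : HasSubgaussianMGF X v P where
  integrable_exp_mul t := by
    have h1 := integrable_exp_mul_gaussianReal (μ := 0) (v := v) t
    rw [← h.map_eq] at h1
    exact h1.comp_aemeasurable h.aemeasurable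
  mgf_le t := by rw [mgf_gaussianReal h.map_eq]; simp

lemma measureReal_lt_sq_sum_Ioc_le {Ω : Type*} [MeasurableSpace Ω] {P : Measure Ω}
    [IsProbabilityMeasure P] {v : ℝ≥0} (hv : 0 < v) {n : ℕ} {Z : ℕ → Ω → ℝ}
    (hlaw : ∀ i ∈ Set.Icc 1 n, HasLaw (Z i) (gaussianReal 0 v) P)
    (hindep : iIndepFun (fun i : Set.Icc 1 n => Z i) P) {x y : ℕ} (hxy : x < y) (hyn : y ≤ n)
    {u : ℝ} (hu : 0 ≤ u) :
    P.real {ω | u * v * ((y : ℝ) - x) < (∑ i ∈ Finset.Ioc x y, Z i ω) ^ 2}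
      ≤ 2 * Real.exp (-(u / 2)) := by
  set s : Finset (Set.Icc 1 n) := (Finset.Ioc x y).subtype (· ∈ Set.Icc 1 n) with hs
  have hsub : ∀ i ∈ Finset.Ioc x y, i ∈ Set.Icc 1 n := fun i hi => by
    have := Finset.mem_Ioc.1 hi
    exact Set.mem_Icc.2 (by omega)
  have h := HasSubgaussianMGF.sum_of_iIndepFun hindep (c := fun _ => v) (s := s)
    fun i _ => hasSubgaussianMGF_of_hasLaw_gaussianReal (hlaw i i.2)
  have hsum : (fun ω => ∑ i ∈ s, Z i ω) = fun ω => ∑ i ∈ Finset.Ioc x y, Z i ω := by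
    funext ω
    exact Finset.sum_subtype_of_mem (fun i => Z i ω) hsub
  have hL : (0 : ℝ) < (y : ℝ) - x := sub_pos.2 (by exact_mod_cast hxy)
  have hc : ((∑ _i ∈ s, v : ℝ≥0) : ℝ) = ((y : ℝ) - x) * v := by
    rw [Finset.sum_const, hs, Finset.card_subtype, Finset.filter_true_of_mem hsub, Nat.card_Ioc,
      nsmul_eq_mul, NNReal.coe_mul, NNReal.coe_natCast, Nat.cast_sub hxy.le]
  rw [hsum] at h
  set E := fun ω => ∑ i ∈ Finset.Ioc x y, Z i ω
  have hv' : (0 : ℝ) < v := by exact_mod_cast hv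
  set r := Real.sqrt (u * v * ((y : ℝ) - x)) with hr
  have hexp : -r ^ 2 / (2 * ((∑ _i ∈ s, v : ℝ≥0) : ℝ)) = -(u / 2) := by
    rw [hr, Real.sq_sqrt (by positivity), hc]
    field_simp
  have h1 := h.measure_ge_le (Real.sqrt_nonneg (u * v * ((y : ℝ) - x)))
  have h2 := h.neg.measure_ge_le (Real.sqrt_nonneg (u * v * ((y : ℝ) - x)))
  rw [← hr, hexp] at h1 h2
  have hsubset : {ω | u * v * ((y : ℝ) - x) < (E ω) ^ 2} ⊆ {ω | r ≤ E ω} ∪ {ω | r ≤ (-E) ω} := by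
    intro ω hω
    have : r ≤ |E ω| := by
      rw [← Real.sqrt_sq_eq_abs]
      exact Real.sqrt_le_sqrt (le_of_lt hω)
    exact le_abs.1 this
  calc P.real {ω | u * v * ((y : ℝ) - x) < (E ω) ^ 2}
      ≤ P.real ({ω | r ≤ E ω} ∪ {ω | r ≤ (-E) ω}) := measureReal_mono hsubset
    _ ≤ P.real {ω | r ≤ E ω} + P.real {ω | r ≤ (-E) ω} := measureReal_union_le _ _
    _ ≤ 2 * Real.exp (-(u / 2)) := by linarith

/-- Every length is approximated from below by a rounded power of `a`, up to a relative error
`a - 1`. -/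
lemma exists_ceil_pow_near {a : ℝ} (ha : 1 < a) {l n : ℕ} (hl : 1 ≤ l) (hln : l ≤ n) :
    ∃ j < ⌊Real.log n / Real.log a⌋₊ + 1,
      0 < ⌈a ^ j⌉₊ ∧ ⌈a ^ j⌉₊ ≤ l ∧ (l : ℝ) - ⌈a ^ j⌉₊ ≤ (a - 1) * l := by
  obtain ⟨j, hj1, hj2⟩ := exists_nat_pow_near (x := (l : ℝ)) (by exact_mod_cast hl) ha
  have ha0 : 0 < a := by linarith
  have hpos : 0 < a ^ j := by positivity
  refine ⟨j, ?_, Nat.ceil_pos.2 hpos, Nat.ceil_le.2 hj1, ?_⟩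
  · rw [Nat.lt_add_one_iff]
    refine Nat.le_floor ?_
    rw [le_div_iff₀ (Real.log_pos ha), ← Real.log_pow]
    exact Real.log_le_log hpos (hj1.trans (by exact_mod_cast hln))
  · have := Nat.le_ceil (a ^ j)
    rw [pow_succ] at hj2
    nlinarith


/-- A bound on the partial sums over a geometric grid of lengths extends to all lengths, at the
price of a slightly larger constant, if a crude bound holds for all partial sums. -/
lemma sq_sum_Ioc_le_of_grid {e : ℕ → ℝ} {l u u' a : ℝ} (hl : 0 ≤ l) (hu : 0 < u) (huu' : u < u')
    (ha : 1 < a) (ha' : (1 + 2 * u / (u' - u)) * (8 * (a - 1)) ≤ (u' - u) / 2) {n x y : ℕ}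
    (hxy : x < y) (hyn : y ≤ n)
    (hcrude : ∀ x' < n, ∀ y' ≤ n, x' < y' →
      (∑ i ∈ Finset.Ioc x' y', e i) ^ 2 ≤ 8 * l * ((y' : ℝ) - x'))
    (hgrid : ∀ j < ⌊Real.log n / Real.log a⌋₊ + 1, 0 < ⌈a ^ j⌉₊ → x + ⌈a ^ j⌉₊ ≤ n →
      (∑ i ∈ Finset.Ioc x (x + ⌈a ^ j⌉₊), e i) ^ 2
        ≤ u * l * (((x + ⌈a ^ j⌉₊ : ℕ) : ℝ) - x)) :
    (∑ i ∈ Finset.Ioc x y, e i) ^ 2 ≤ u' * l * ((y : ℝ) - x) := by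
  obtain ⟨j, hj, hg0, hgl, hnear⟩ := exists_ceil_pow_near ha (l := y - x) (n := n)
    (by omega) (by omega)
  have h1 := hgrid j hj hg0 (by omega)
  set g := ⌈a ^ j⌉₊
  rw [Nat.cast_sub hxy.le] at hnear
  push_cast at h1
  rw [add_sub_cancel_left] at h1
  set N : ℝ := (y : ℝ) - x
  have hgN : (g : ℝ) ≤ N := by
    have : ((g + x : ℕ) : ℝ) ≤ y := by exact_mod_cast (by omega : g + x ≤ y)
    push_cast at this
    simp only [N]; linarith
  have hN : 0 ≤ N := (Nat.cast_nonneg g).trans hgN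
  set A := ∑ i ∈ Finset.Ioc x (x + g), e i
  set B := ∑ i ∈ Finset.Ioc (x + g) y, e i
  have hAB : ∑ i ∈ Finset.Ioc x y, e i = A + B :=
    (Finset.sum_Ioc_consecutive e (by omega) (by omega)).symm
  have h2 : B ^ 2 ≤ 8 * l * ((a - 1) * N) := by
    rcases eq_or_lt_of_le (show x + g ≤ y by omega) with h | h
    · have : B = 0 := by simp [B, h]
      rw [this]
      have : 0 ≤ 8 * l * ((a - 1) * N) := by
        have : 0 ≤ a - 1 := by linarith
        positivity
      simpa using this
    · refine (hcrude _ (by omega) y hyn h).trans ?_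
      push_cast
      refine mul_le_mul_of_nonneg_left ?_ (by positivity)
      simp only [N] at hnear ⊢
      linarith
  have h1' : A ^ 2 ≤ u * l * N := h1.trans (mul_le_mul_of_nonneg_left hgN (by positivity))
  set t := (u' - u) / (2 * u) with ht
  have htpos : 0 < t := div_pos (by linarith) (by linarith)
  have htu : t * u = (u' - u) / 2 := by rw [ht]; field_simp
  have htinv : 1 / t = 2 * u / (u' - u) := by rw [ht, one_div_div]
  -- Young's inequality with the weight `t`
  have hyoung : (A + B) ^ 2 ≤ (1 + t) * A ^ 2 + (1 + 1 / t) * B ^ 2 := by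
    have h3 : (1 + t) * A ^ 2 + (1 + 1 / t) * B ^ 2 - (A + B) ^ 2 = (t * A - B) ^ 2 / t := by
      field_simp
      ring
    have h4 : 0 ≤ (t * A - B) ^ 2 / t := by positivity
    linarith
  rw [hAB]
  have hlN : 0 ≤ l * N := mul_nonneg hl hN
  have hti : 0 ≤ 1 + 1 / t := by positivity
  calc (A + B) ^ 2 ≤ (1 + t) * A ^ 2 + (1 + 1 / t) * B ^ 2 := hyoung
    _ ≤ (1 + t) * (u * l * N) + (1 + 1 / t) * (8 * l * ((a - 1) * N)) := by gcongr
    _ = (u + t * u) * (l * N) + ((1 + 1 / t) * (8 * (a - 1))) * (l * N) := by ring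
    _ ≤ (u + (u' - u) / 2) * (l * N) + ((u' - u) / 2) * (l * N) := by
      rw [htu, htinv]
      gcongr
    _ = u' * l * N := by ring

lemma measureReal_biUnion_le_card_mul {Ω ι : Type*} [MeasurableSpace Ω] {P : Measure Ω}
    [IsProbabilityMeasure P] (s : Finset ι) (B : ι → Set Ω) {c : ℝ}
    (h : ∀ i ∈ s, P.real (B i) ≤ c) : P.real (⋃ i ∈ s, B i) ≤ s.card * c := by
  refine (measureReal_biUnion_finset_le s B).trans ?_
  rw [← nsmul_eq_mul]
  exact Finset.sum_le_card_nsmul s _ c h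

/-- Maximal inequality: for starting points in `X n`, a set of at most `C n ^ κ` points, all the
normalised squared partial sums are at most `u' v log n` with probability tending to one,
provided `κ < u' / 2`. -/
lemma tendsto_measure_exists_lt_sq_sum {Ω : Type*} [MeasurableSpace Ω] {P : Measure Ω}
    [IsProbabilityMeasure P] {v : ℝ≥0} (hv : 0 < v) {Z : ℕ → ℕ → Ω → ℝ}
    (hlaw : ∀ n, ∀ i ∈ Set.Icc 1 n, HasLaw (Z n i) (gaussianReal 0 v) P)
    (hindep : ∀ n, iIndepFun (fun i : Set.Icc 1 n => Z n i) P) {u' κ C : ℝ} (hκ : 0 ≤ κ)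
    (hκu : κ < u' / 2) {X : ℕ → Finset ℕ}
    (hX : ∀ᶠ n in atTop, ((X n).card : ℝ) ≤ C * (n : ℝ) ^ κ) :
    Tendsto (fun n : ℕ => P {ω | ∃ x ∈ X n, ∃ y, x < y ∧ y ≤ n ∧
      u' * (v * Real.log n) * ((y : ℝ) - x) < (∑ i ∈ Finset.Ioc x y, Z n i ω) ^ 2})
      atTop (𝓝 0) := by
  set u := (u' + 2 * κ) / 2 with hu_def
  have hu : 0 < u := by rw [hu_def]; linarith
  have huu' : u < u' := by rw [hu_def]; linarith
  have hκu2 : κ < u / 2 := by rw [hu_def]; linarith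
  set η := (u' - u) / (16 * (1 + 2 * u / (u' - u))) with hη
  have hd : 0 < u' - u := by linarith
  have hq : 0 < 1 + 2 * u / (u' - u) := by positivity
  have hηpos : 0 < η := by positivity
  set a := 1 + η with ha_def
  have ha : 1 < a := by linarith
  have ha' : (1 + 2 * u / (u' - u)) * (8 * (a - 1)) ≤ (u' - u) / 2 := by
    rw [ha_def, add_sub_cancel_left, hη]
    apply le_of_eq
    generalize 1 + 2 * u / (u' - u) = q at *
    field_simp
    norm_num
  have hv' : (0 : ℝ) < v := by exact_mod_cast hv
  have hloga := Real.log_pos ha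
  set J : ℕ → ℕ := fun n => ⌊Real.log n / Real.log a⌋₊ + 1
  -- the two families of exceptional events
  set B₁ : ℕ → ℕ × ℕ → Set Ω := fun n p => {ω | p.1 < p.2 ∧ p.2 ≤ n ∧
    (8 * Real.log n) * v * ((p.2 : ℝ) - p.1) < (∑ i ∈ Finset.Ioc p.1 p.2, Z n i ω) ^ 2} with hB₁
  set B₂ : ℕ → ℕ × ℕ → Set Ω := fun n p => {ω | 0 < ⌈a ^ p.2⌉₊ ∧ p.1 + ⌈a ^ p.2⌉₊ ≤ n ∧
    (u * Real.log n) * v * (((p.1 + ⌈a ^ p.2⌉₊ : ℕ) : ℝ) - p.1)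
      < (∑ i ∈ Finset.Ioc p.1 (p.1 + ⌈a ^ p.2⌉₊), Z n i ω) ^ 2} with hB₂
  have hlog : ∀ n : ℕ, 0 ≤ Real.log n := fun n => Real.log_natCast_nonneg n
  have hP₁ : ∀ n p, P.real (B₁ n p) ≤ 2 * Real.exp (-(8 * Real.log n / 2)) := by
    intro n p
    by_cases h : p.1 < p.2 ∧ p.2 ≤ n
    · refine (measureReal_mono fun ω hω => ?_).trans
        (measureReal_lt_sq_sum_Ioc_le hv (hlaw n) (hindep n) h.1 h.2
          (u := 8 * Real.log n) (by have := hlog n; positivity))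
      exact hω.2.2
    · have : B₁ n p = ∅ := by
        ext ω
        simp only [hB₁, Set.mem_ofPred_eq, Set.mem_empty_iff_false, iff_false]
        tauto
      rw [this, measureReal_empty]
      positivity
  have hP₂ : ∀ n p, P.real (B₂ n p) ≤ 2 * Real.exp (-(u * Real.log n / 2)) := by
    intro n p
    by_cases h : 0 < ⌈a ^ p.2⌉₊ ∧ p.1 + ⌈a ^ p.2⌉₊ ≤ n
    · refine (measureReal_mono fun ω hω => ?_).trans
        (measureReal_lt_sq_sum_Ioc_le hv (hlaw n) (hindep n) (x := p.1)
          (y := p.1 + ⌈a ^ p.2⌉₊) (by omega) h.2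
          (u := u * Real.log n) (by have := hlog n; positivity))
      exact hω.2.2
    · have : B₂ n p = ∅ := by
        ext ω
        simp only [hB₂, Set.mem_ofPred_eq, Set.mem_empty_iff_false, iff_false]
        tauto
      rw [this, measureReal_empty]
      positivity
  have hincl : ∀ n : ℕ, {ω | ∃ x ∈ X n, ∃ y, x < y ∧ y ≤ n ∧
      u' * (v * Real.log n) * ((y : ℝ) - x) < (∑ i ∈ Finset.Ioc x y, Z n i ω) ^ 2}
      ⊆ (⋃ p ∈ Finset.range n ×ˢ Finset.range (n + 1), B₁ n p)
        ∪ ⋃ p ∈ X n ×ˢ Finset.range (J n), B₂ n p := by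
    rintro n ω ⟨x, hx, y, hxy, hyn, hbig⟩
    by_contra hcon
    simp only [Set.mem_union, Set.mem_iUnion, not_or, not_exists] at hcon
    refine absurd hbig (not_lt.2 ?_)
    refine sq_sum_Ioc_le_of_grid (e := fun i => Z n i ω) (mul_nonneg hv'.le (hlog n)) hu huu' ha
      ha' hxy hyn (fun x' hx' y' hy' hxy' => ?_) fun j hj hg0 hgn => ?_
    · by_contra h
      refine hcon.1 (x', y') (Finset.mem_product.2
        ⟨Finset.mem_range.2 hx', Finset.mem_range.2 (by simpa [Nat.lt_succ_iff] using hy')⟩)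
        ⟨hxy', hy', ?_⟩
      have := not_le.1 h
      simp only
      calc _ = 8 * (v * Real.log n) * ((y' : ℝ) - x') := by ring
        _ < _ := this
    · by_contra h
      refine hcon.2 (x, j) (Finset.mem_product.2 ⟨hx, Finset.mem_range.2 hj⟩) ⟨hg0, hgn, ?_⟩
      have := not_le.1 h
      simp only
      calc _ = u * (v * Real.log n) * (((x + ⌈a ^ j⌉₊ : ℕ) : ℝ) - x) := by ring
        _ < _ := this
  have hbound : ∀ᶠ n : ℕ in atTop, P.real {ω | ∃ x ∈ X n, ∃ y, x < y ∧ y ≤ n ∧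
      u' * (v * Real.log n) * ((y : ℝ) - x) < (∑ i ∈ Finset.Ioc x y, Z n i ω) ^ 2}
      ≤ 4 * (n : ℝ) ^ (-2 : ℝ)
        + 2 * C * (Real.log n / (n : ℝ) ^ (u / 2 - κ) / Real.log a + (n : ℝ) ^ (-(u / 2 - κ))) := by
    filter_upwards [hX, eventually_ge_atTop 1] with n hXn hn
    have hn0 : (0 : ℝ) < n := by exact_mod_cast hn
    have hn1 : (1 : ℝ) ≤ n := by exact_mod_cast hn
    refine (measureReal_mono (hincl n)).trans ((measureReal_union_le _ _).trans (add_le_add ?_ ?_))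
    · refine (measureReal_biUnion_le_card_mul _ _ fun p _ => hP₁ n p).trans ?_
      rw [Finset.card_product, Finset.card_range, Finset.card_range]
      have h1 : Real.exp (-(8 * Real.log n / 2)) = (n : ℝ) ^ (-2 : ℝ) * (n : ℝ) ^ (-2 : ℝ) := by
        rw [← Real.rpow_add hn0, Real.rpow_def_of_pos hn0]; congr 1; ring
      have h2 : (n : ℝ) ^ (-2 : ℝ) * (n * n) = 1 := by
        rw [Real.rpow_neg hn0.le, Real.rpow_two]; field_simp
      rw [h1]
      push_cast
      set w := (n : ℝ) ^ (-2 : ℝ)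
      have hw : 0 ≤ w := by positivity
      calc (n : ℝ) * (n + 1) * (2 * (w * w)) ≤ n * (n + n) * (2 * (w * w)) := by gcongr
        _ = 4 * w * (w * (n * n)) := by ring
        _ = 4 * w := by rw [h2, mul_one]
    · refine (measureReal_biUnion_le_card_mul _ _ fun p _ => hP₂ n p).trans ?_
      rw [Finset.card_product, Finset.card_range]
      have h1 : Real.exp (-(u * Real.log n / 2)) = (n : ℝ) ^ (-(u / 2)) := by
        rw [Real.rpow_def_of_pos hn0]; congr 1; ring
      have h2 : (n : ℝ) ^ κ * (n : ℝ) ^ (-(u / 2)) = (n : ℝ) ^ (-(u / 2 - κ)) := by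
        rw [← Real.rpow_add hn0]; congr 1; ring
      have h3 : (J n : ℝ) ≤ Real.log n / Real.log a + 1 := by
        simp only [J]; push_cast
        have := Nat.floor_le (div_nonneg (hlog n) hloga.le)
        linarith
      have h4 : Real.log n / (n : ℝ) ^ (u / 2 - κ) = Real.log n * (n : ℝ) ^ (-(u / 2 - κ)) := by
        rw [Real.rpow_neg hn0.le]; rfl
      rw [h1, h4]
      push_cast
      have hw : 0 ≤ (n : ℝ) ^ (-(u / 2)) := by positivity
      calc ((X n).card : ℝ) * (J n) * (2 * (n : ℝ) ^ (-(u / 2)))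
          ≤ (C * (n : ℝ) ^ κ) * (Real.log n / Real.log a + 1) * (2 * (n : ℝ) ^ (-(u / 2))) := by
            have : (0 : ℝ) ≤ (X n).card := Nat.cast_nonneg _
            gcongr
            exact this.trans hXn
        _ = 2 * C * ((Real.log n / Real.log a + 1) * ((n : ℝ) ^ κ * (n : ℝ) ^ (-(u / 2)))) := by ring
        _ = _ := by rw [h2]; ring
  have hlim : Tendsto (fun n : ℕ => 4 * (n : ℝ) ^ (-2 : ℝ)
        + 2 * C * (Real.log n / (n : ℝ) ^ (u / 2 - κ) / Real.log a + (n : ℝ) ^ (-(u / 2 - κ))))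
      atTop (𝓝 0) := by
    have hpos : 0 < u / 2 - κ := by linarith
    have h1 := (tendsto_rpow_neg_atTop (show (0 : ℝ) < 2 by norm_num)).comp
      (tendsto_natCast_atTop_atTop (R := ℝ))
    have h2 := (tendsto_rpow_neg_atTop hpos).comp (tendsto_natCast_atTop_atTop (R := ℝ))
    have h3 := ((isLittleO_log_rpow_atTop hpos).tendsto_div_nhds_zero).comp
      (tendsto_natCast_atTop_atTop (R := ℝ))
    have := (h1.const_mul 4).add (((h3.div_const (Real.log a)).add h2).const_mul (2 * C))
    simpa [Function.comp_def] using this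
  have hreal := squeeze_zero' (Eventually.of_forall fun n => measureReal_nonneg) hbound hlim
  have := ENNReal.tendsto_ofReal hreal
  rw [ENNReal.ofReal_zero] at this
  refine this.congr fun n => ?_
  exact ofReal_measureReal

/-! ### Localisation and counting of changepoints on the event of small noise -/

/-- All normalised squared partial sums of `e_1, …, e_n` are at most `t`, and those that start
right after a point of the small set `A` are at most `s`. -/
def NoiseBound (A : Finset ℕ) (s t : ℝ) (n : ℕ) (e : ℕ → ℝ) : Prop :=
  ∀ x y, x < y → y ≤ n →
    (∑ i ∈ Finset.Ioc x y, e i) ^ 2 ≤ (if x ∈ A then s else t) * ((y : ℝ) - x)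

/-- The changepoints of `S` outside `A` contribute `t` each, all others only `s`. -/
lemma sum_noise_le {A S R X : Finset ℕ} {s t : ℝ} (hs : 0 ≤ s) (ht : 0 ≤ t) (hR : R ⊆ A)
    (hX : X ⊆ S ∪ R) :
    ∑ x ∈ X, (if x ∈ A then s else t)
      ≤ (S \ A).card * t + (S ∩ A).card * s + R.card * s := by
  have h0 : ∀ x, 0 ≤ if x ∈ A then s else t := fun x => by split_ifs <;> assumption
  have h1 : ∑ x ∈ S ∪ R, (if x ∈ A then s else t)
      ≤ ∑ x ∈ S, (if x ∈ A then s else t) + ∑ x ∈ R, (if x ∈ A then s else t) := by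
    rw [← Finset.sum_union_inter]
    exact le_add_of_nonneg_right (Finset.sum_nonneg fun x _ => h0 x)
  have h2 : ∑ x ∈ R, (if x ∈ A then s else t) = R.card * s := by
    rw [Finset.sum_congr rfl fun x hx => if_pos (hR hx), Finset.sum_const, nsmul_eq_mul]
  have h3 : ∑ x ∈ S, (if x ∈ A then s else t) = (S \ A).card * t + (S ∩ A).card * s := by
    rw [← Finset.sum_sdiff (Finset.inter_subset_left (s₁ := S) (s₂ := A)), Finset.sdiff_inter_self_left,
      Finset.sum_congr rfl fun x hx => if_neg (Finset.mem_sdiff.1 hx).2,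
      Finset.sum_congr (rfl : S ∩ A = S ∩ A) fun x hx => if_pos (Finset.mem_inter.1 hx).2]
    simp only [Finset.sum_const, nsmul_eq_mul]
  have h4 := Finset.sum_le_sum_of_subset_of_nonneg hX fun x _ _ => h0 x
  linarith

lemma card_sdiff_add_card_inter_real (S A : Finset ℕ) :
    (S.card : ℝ) = (S \ A).card + (S ∩ A).card := by
  exact_mod_cast (Finset.card_sdiff_add_card_inter S A).symm

section Comparison

variable {f e : ℕ → ℝ} {a b n : ℕ} {A B S S₀ Q : Finset ℕ} {s t β U : ℝ}

/-- If an optimal `S` misses the true changepoint `τ` by more than `d`, then `d` cannot be large: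
otherwise the competitor `S₀`, of cost at most `U` above the noise energy, would be better. -/
lemma IsPELT.jump_le (hS : IsPELT (fun i => f i + e i) β (a + 1) b B S)
    (hS₀ : S₀ ⊆ B ∩ Finset.Ico (a + 1) b)
    (hcost : penCost (fun i => f i + e i) β (a + 1) b S₀
      ≤ ∑ i ∈ Finset.Ioc a b, e i ^ 2 + U + (S₀.card + 1) * β)
    (hbn : b ≤ n) (hs : 0 ≤ s) (hst : s ≤ t) (htβ : t ≤ β) (hnoise : NoiseBound A s t n e)
    (hQ : Q ⊆ Finset.Ico (a + 1) b) (hf : ConstOff Q (a + 1) b f) (haA : a ∈ A) (hQA : Q ⊆ A)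
    {τ d : ℕ} (hτ : τ ∈ Q) (hd : 0 < d) (had : a + d < τ) (hdb : τ + d < b)
    (hA₁ : τ - d ∈ A) (hA₂ : τ + d ∈ A) (hSd : ∀ x ∈ S, x < τ - d ∨ τ + d < x)
    (hQd : ∀ x ∈ Q, x ≠ τ → x < τ - d ∨ τ + d < x) :
    d * (f (τ + 1) - f τ) ^ 2 / 4 + (S ∩ A).card * (β - s)
      ≤ U + S₀.card * β + (Q.card + 5) * s := by
  have h1 := noise_sub_add_jump_le_penCost β (w := fun x => if x ∈ A then s else t) (e := e)
    (hS.1.trans Finset.inter_subset_right) hQ hf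
    (fun x y _ hxy hy => hnoise x y hxy (hy.trans hbn)) hτ hd had hdb hSd hQd
  have h2 := hS.2 S₀ hS₀
  have h3 := sum_noise_le (S := S) (R := insert a (Q ∪ {τ - d, τ + d})) hs (hs.trans hst)
    (show insert a (Q ∪ {τ - d, τ + d}) ⊆ A by
      intro x hx
      simp only [Finset.mem_insert, Finset.mem_union, Finset.mem_singleton] at hx
      rcases hx with rfl | h | rfl | rfl
      exacts [haA, hQA h, hA₁, hA₂])
    (X := insert a (S ∪ Q ∪ {τ - d, τ + d})) (by
      intro x hx
      simp only [Finset.mem_insert, Finset.mem_union, Finset.mem_singleton] at hx ⊢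
      tauto)
  have h4 : ((insert a (Q ∪ {τ - d, τ + d})).card : ℝ) ≤ Q.card + 3 := by
    have := Finset.card_insert_le a (Q ∪ {τ - d, τ + d})
    have := Finset.card_union_le Q {τ - d, τ + d}
    have := Finset.card_le_two (a := τ - d) (b := τ + d)
    exact_mod_cast (by omega : (insert a (Q ∪ {τ - d, τ + d})).card ≤ Q.card + 3)
  have h5 := mul_le_mul_of_nonneg_right h4 hs
  have h6 := card_sdiff_add_card_inter_real S A
  have h7 : ((S \ A).card : ℝ) * t ≤ (S \ A).card * β :=
    mul_le_mul_of_nonneg_left htβ (Nat.cast_nonneg _)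
  simp only [if_pos hA₁, if_pos (hQA hτ)] at h1
  rw [h6] at h1
  linarith

/-- Comparison of an optimal `S` with a competitor `S₀`: every changepoint of `S` outside `A` is
charged `β - t`, and every one in `A`, where the noise sums are small, the larger `β - s`. -/
lemma IsPELT.card_le (hS : IsPELT (fun i => f i + e i) β (a + 1) b B S)
    (hS₀ : S₀ ⊆ B ∩ Finset.Ico (a + 1) b)
    (hcost : penCost (fun i => f i + e i) β (a + 1) b S₀
      ≤ ∑ i ∈ Finset.Ioc a b, e i ^ 2 + U + (S₀.card + 1) * β)
    (hab : a < b) (hbn : b ≤ n) (hs : 0 ≤ s) (hst : s ≤ t) (hnoise : NoiseBound A s t n e)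
    (hQ : Q ⊆ Finset.Ico (a + 1) b) (hf : ConstOff Q (a + 1) b f) (haA : a ∈ A) (hQA : Q ⊆ A) :
    (S \ A).card * (β - t) + (S ∩ A).card * (β - s) ≤ U + S₀.card * β + (Q.card + 1) * s := by
  have h1 := noise_sub_le_penCost hab β (w := fun x => if x ∈ A then s else t) (e := e)
    (hS.1.trans Finset.inter_subset_right) hQ hf
    (fun x y _ hxy hy => hnoise x y hxy (hy.trans hbn))
  have h2 := hS.2 S₀ hS₀
  have h3 := sum_noise_le (S := S) (R := insert a Q) hs (hs.trans hst)
    (Finset.insert_subset haA hQA) (X := insert a (S ∪ Q)) (by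
      intro x hx
      simp only [Finset.mem_insert, Finset.mem_union] at hx ⊢
      tauto)
  have h4 : ((insert a Q).card : ℝ) ≤ Q.card + 1 := by
    exact_mod_cast Finset.card_insert_le a Q
  have h5 := mul_le_mul_of_nonneg_right h4 hs
  have h6 := card_sdiff_add_card_inter_real S A
  rw [h6] at h1
  linarith

/-- PELT on a block with a single true changepoint `τ` returns a changepoint within `ρ` of `τ`.
There is one within the larger distance `r`, because missing a whole window of radius `r` costs more
than the penalty `β`. That one lies in `A` and hence saves at most `s` of noise; its penalty already
uses up the whole penalty of the competitor `{τ}`, so that missing the smaller window of radius `ρ`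
can only be compensated by a few multiples of `s`. -/
lemma IsPELT.exists_near {T : Finset ℕ}
    (hT : IsPELT (fun i => f i + e i) β (a + 1) b (Finset.Icc (a + 1) b) T)
    (hbn : b ≤ n) (hs : 0 ≤ s) (hst : s ≤ t) (htβ : t ≤ β) (hnoise : NoiseBound A s t n e)
    {τ ρ r : ℕ} (hf : ConstOff {τ} (a + 1) b f) (haA : a ∈ A)
    (hA : Finset.Icc (τ - r) (τ + r) ⊆ A)
    (har : a + r < τ) (hrb : τ + r < b) (hρ : 0 < ρ) (hρr : ρ ≤ r)
    (hr_large : β + 6 * s < r * (f (τ + 1) - f τ) ^ 2 / 4)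
    (hρ_large : 7 * s < ρ * (f (τ + 1) - f τ) ^ 2 / 4) :
    ∃ c ∈ T, τ ≤ c + ρ ∧ c ≤ τ + ρ := by
  have hτmem : {τ} ⊆ Finset.Ico (a + 1) b :=
    Finset.singleton_subset_iff.2 (Finset.mem_Ico.2 (by omega))
  have hcost : penCost (fun i => f i + e i) β (a + 1) b {τ}
      ≤ ∑ i ∈ Finset.Ioc a b, e i ^ 2 + 0 + (({τ} : Finset ℕ).card + 1) * β := by
    have hIcc : Finset.Icc (a + 1) b = Finset.Ioc a b := by ext; simp
    have := penCost_le_of_constOff (fun i => f i + e i) β (show a + 1 ≤ b by omega) hτmem hf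
    simpa [hIcc] using this
  have hcomp : {τ} ⊆ Finset.Icc (a + 1) b ∩ Finset.Ico (a + 1) b :=
    Finset.singleton_subset_iff.2 (Finset.mem_inter.2
      ⟨Finset.mem_Icc.2 (by omega), Finset.mem_Ico.2 (by omega)⟩)
  have hwin : ∀ x, τ - r ≤ x → x ≤ τ + r → x ∈ A := fun x h1 h2 => hA (Finset.mem_Icc.2 ⟨h1, h2⟩)
  have hQA : {τ} ⊆ A := Finset.singleton_subset_iff.2 (hwin τ (by omega) (by omega))
  have main : ∀ d, 0 < d → d ≤ r → (∀ x ∈ T, x < τ - d ∨ τ + d < x) →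
      d * (f (τ + 1) - f τ) ^ 2 / 4 + (T ∩ A).card * (β - s) ≤ β + 6 * s := by
    intro d hd hdr hTd
    have := hT.jump_le hcomp hcost hbn hs hst htβ hnoise hτmem hf haA hQA
      (Finset.mem_singleton_self τ) hd (by omega) (by omega) (hwin _ (by omega) (by omega))
      (hwin _ (by omega) (by omega)) hTd fun x hx hne => absurd (Finset.mem_singleton.1 hx) hne
    rw [Finset.card_singleton] at this
    push_cast at this
    linarith
  have hβs : 0 ≤ β - s := by linarith
  obtain ⟨p, hpT, hp⟩ : ∃ p ∈ T, τ - r ≤ p ∧ p ≤ τ + r := by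
    by_contra! hcon
    have h1 := main r (by omega) le_rfl fun x hx => by have := hcon x hx; omega
    have : 0 ≤ ((T ∩ A).card : ℝ) * (β - s) := by positivity
    linarith
  by_contra! hcon
  have h1 := main ρ hρ hρr fun x hx => by have := hcon x hx; omega
  have h2 : (1 : ℝ) ≤ (T ∩ A).card := by
    exact_mod_cast Finset.card_pos.2 ⟨p, Finset.mem_inter.2 ⟨hpT, hwin p hp.1 hp.2⟩⟩
  have h3 := mul_le_mul_of_nonneg_right h2 hβs
  linarith

end Comparison

/-! ### Step functions -/

/-- The function on the positive integers that takes the values `μ 0, …, μ m` in this order, with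
changepoints `c j`. By definition `signal θ μ n` is `stepSignal (trueChange θ n) μ`. -/
noncomputable def stepSignal {m : ℕ} (c : Fin m → ℕ) (μ : Fin (m + 1) → ℝ) (i : ℕ) : ℝ :=
  μ ⟨(Finset.univ.filter fun j : Fin m => c j < i).card,
    Nat.lt_succ_of_le ((Finset.card_le_univ _).trans_eq (Fintype.card_fin m))⟩

lemma stepSignal_congr {m : ℕ} {c c' : Fin m → ℕ} (μ : Fin (m + 1) → ℝ) {i i' : ℕ}
    (h : ∀ j, c j < i ↔ c' j < i') : stepSignal c μ i = stepSignal c' μ i' := by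
  unfold stepSignal
  congr 2
  simp only [h]

lemma constOff_stepSignal {m : ℕ} {c : Fin m → ℕ} (μ : Fin (m + 1) → ℝ) {S : Finset ℕ} {a b : ℕ}
    (h : ∀ j, c j ∈ S ∨ c j < a ∨ b ≤ c j) : ConstOff S a b (stepSignal c μ) := by
  intro i i' hi hii' hi' hS
  refine stepSignal_congr μ fun j => ?_
  rcases h j with hj | hj | hj
  · have := hS _ hj; omega
  · omega
  · omega

lemma stepSignal_jump {m : ℕ} {c : Fin m → ℕ} (hc : StrictMono c) (μ : Fin (m + 1) → ℝ)
    (k : Fin m) :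
    stepSignal c μ (c k + 1) - stepSignal c μ (c k) = μ k.succ - μ k.castSucc := by
  have h1 : (Finset.univ.filter fun j : Fin m => c j < c k) = Finset.Iio k := by
    ext j; simp [hc.lt_iff_lt]
  have h2 : (Finset.univ.filter fun j : Fin m => c j < c k + 1) = Finset.Iic k := by
    ext j; simp [hc.le_iff_le]
  unfold stepSignal
  congr 2
  · ext; simp only [h2, Fin.card_Iic, Fin.val_succ]
  · ext; simp only [h1, Fin.card_Iio, Fin.val_castSucc]

/-- Moving each changepoint by at most `ρ` changes the step function in at most `m ρ` places. -/
lemma sum_sq_stepSignal_sub_le {m : ℕ} {c c' : Fin m → ℕ} {μ : Fin (m + 1) → ℝ} {K : ℝ}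
    (hK : ∀ i j, (μ i - μ j) ^ 2 ≤ K) {ρ : ℕ} (hc : ∀ j, c j ≤ c' j + ρ ∧ c' j ≤ c j + ρ)
    (I : Finset ℕ) :
    ∑ i ∈ I, (stepSignal c μ i - stepSignal c' μ i) ^ 2 ≤ m * ρ * K := by
  have hK0 : 0 ≤ K := (sq_nonneg _).trans (hK 0 0)
  set D : Finset ℕ := Finset.univ.biUnion fun j : Fin m =>
    Finset.Ioc (min (c j) (c' j)) (max (c j) (c' j)) with hD
  have hcard : (D.card : ℝ) ≤ m * ρ := by
    have : D.card ≤ m * ρ := by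
      refine (Finset.card_biUnion_le_card_mul _ _ ρ fun j _ => ?_).trans_eq (by simp)
      have := hc j
      rw [Nat.card_Ioc]
      omega
    exact_mod_cast this
  have hle : ∀ i ∈ I, (stepSignal c μ i - stepSignal c' μ i) ^ 2 ≤ if i ∈ D then K else 0 := by
    intro i _
    split_ifs with h
    · exact hK _ _
    · rw [stepSignal_congr (c' := c') (i' := i) μ, sub_self, zero_pow two_ne_zero]
      intro j
      have : i ∉ Finset.Ioc (min (c j) (c' j)) (max (c j) (c' j)) := fun hi =>
        h (Finset.mem_biUnion.2 ⟨j, Finset.mem_univ _, hi⟩)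
      rw [Finset.mem_Ioc] at this
      omega
  calc ∑ i ∈ I, (stepSignal c μ i - stepSignal c' μ i) ^ 2
      ≤ ∑ i ∈ I, (if i ∈ D then K else 0) := Finset.sum_le_sum hle
    _ = ((I.filter (· ∈ D)).card : ℝ) * K := by
      rw [← Finset.sum_filter, Finset.sum_const, nsmul_eq_mul]
    _ ≤ (D.card : ℝ) * K := by
      have : (I.filter (· ∈ D)).card ≤ D.card :=
        Finset.card_le_card fun x hx => (Finset.mem_filter.1 hx).2
      gcongr
    _ ≤ m * ρ * K := by gcongr

/-- A set of `m` integers that meets `m` well-separated windows recovers their centres. -/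
lemma recovers_of_near {m : ℕ} {τ : Fin m → ℕ} {r r' : ℕ} (hrr' : r ≤ r') {S : Finset ℕ}
    (hcard : S.card = m) {p : Fin m → ℕ} (hpS : ∀ j, p j ∈ S) (hp : StrictMono p)
    (hpτ : ∀ j, τ j ≤ p j + r ∧ p j ≤ τ j + r) : Recovers τ r' S := by
  refine ⟨hcard, fun j => ?_⟩
  rw [← Finset.orderEmbOfFin_unique hcard hpS hp, abs_le]
  have h1 : (τ j : ℝ) ≤ p j + r := by exact_mod_cast (hpτ j).1
  have h2 : (p j : ℝ) ≤ τ j + r := by exact_mod_cast (hpτ j).2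
  have h3 : (r : ℝ) ≤ r' := by exact_mod_cast hrr'
  constructor <;> linarith

/-- PELT on all the data with a candidate near each true changepoint recovers the true
changepoints, whatever the other candidates are. -/
lemma IsPELT.recovers {m n : ℕ} {τ : Fin m → ℕ} {μ : Fin (m + 1) → ℝ} {e : ℕ → ℝ}
    {A B S : Finset ℕ} {s t β K : ℝ} {ρ r r' : ℕ}
    (hS : IsPELT (fun i => stepSignal τ μ i + e i) β 1 n B S)
    (hs : 0 ≤ s) (hst : s ≤ t) (htβ : t ≤ β) (hnoise : NoiseBound A s t n e)
    (hK : ∀ i j, (μ i - μ j) ^ 2 ≤ K) (hr : 0 < r) (hρr : ρ ≤ r) (hrr' : r ≤ r') (hn : 0 < n)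
    (hsep : ∀ i j, i < j → τ i + 2 * r < τ j) (hlo : ∀ j, r < τ j) (hhi : ∀ j, τ j + r < n)
    (h0A : 0 ∈ A) (hA : ∀ j, Finset.Icc (τ j - r) (τ j + r) ⊆ A)
    (hB : ∀ j, ∃ c ∈ B, τ j ≤ c + ρ ∧ c ≤ τ j + ρ)
    (hjump : ∀ k : Fin m,
      m * β + (3 * m + 6) * s + 2 * (m * ρ * K) < r * (μ k.succ - μ k.castSucc) ^ 2 / 4)
    (hcount : (4 * m + 2) * s + 2 * (m * ρ * K) < β - t) :
    Recovers τ r' S := by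
  have hτmono : StrictMono τ := fun i j hij => by have := hsep i j hij; omega
  choose c hcB hc using hB
  have hcmono : StrictMono c := fun i j hij => by
    have := hsep i j hij; have := hc i; have := hc j; omega
  set Q : Finset ℕ := Finset.univ.image τ with hQdef
  set S₀ : Finset ℕ := Finset.univ.image c with hS₀def
  have hQcard : Q.card = m := by
    rw [hQdef, Finset.card_image_of_injective _ hτmono.injective, Finset.card_univ,
      Fintype.card_fin]
  have hS₀card : S₀.card = m := by
    rw [hS₀def, Finset.card_image_of_injective _ hcmono.injective, Finset.card_univ,
      Fintype.card_fin]
  have hQmem : ∀ x, x ∈ Q ↔ ∃ j, τ j = x := fun x => by simp [hQdef]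
  have hS₀mem : ∀ x, x ∈ S₀ ↔ ∃ j, c j = x := fun x => by simp [hS₀def]
  have hQ : Q ⊆ Finset.Ico (0 + 1) n := fun x hx => by
    obtain ⟨j, rfl⟩ := (hQmem x).1 hx
    have := hlo j; have := hhi j
    exact Finset.mem_Ico.2 (by omega)
  have hS₀ : S₀ ⊆ Finset.Ico (0 + 1) n := fun x hx => by
    obtain ⟨j, rfl⟩ := (hS₀mem x).1 hx
    have := hlo j; have := hhi j; have := hc j
    exact Finset.mem_Ico.2 (by omega)
  have hS₀B : S₀ ⊆ B ∩ Finset.Ico (0 + 1) n := fun x hx => by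
    refine Finset.mem_inter.2 ⟨?_, hS₀ hx⟩
    obtain ⟨j, rfl⟩ := (hS₀mem x).1 hx
    exact hcB j
  have hwin : ∀ j x, τ j ≤ x + r → x ≤ τ j + r → x ∈ A := fun j x h1 h2 =>
    hA j (Finset.mem_Icc.2 (by omega))
  have hQA : Q ⊆ A := fun x hx => by
    obtain ⟨j, rfl⟩ := (hQmem x).1 hx
    exact hwin j _ (by omega) (by omega)
  have hS₀A : S₀ ⊆ A := fun x hx => by
    obtain ⟨j, rfl⟩ := (hS₀mem x).1 hx
    have := hc j
    exact hwin j _ (by omega) (by omega)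
  have hf : ConstOff Q (0 + 1) n (stepSignal τ μ) :=
    constOff_stepSignal μ fun j => Or.inl ((hQmem _).2 ⟨j, rfl⟩)
  have hg : ConstOff S₀ (0 + 1) n (stepSignal c μ) :=
    constOff_stepSignal μ fun j => Or.inl ((hS₀mem _).2 ⟨j, rfl⟩)
  have hcost : penCost (fun i => stepSignal τ μ i + e i) β (0 + 1) n S₀
      ≤ ∑ i ∈ Finset.Ioc 0 n, e i ^ 2 + ((2 * m + 1) * s + 2 * (m * ρ * K))
        + (S₀.card + 1) * β := by
    have h1 := penCost_le_noise_add hn β hS₀ hQ hf hg (e := e) (w := s) fun x hx y hxy hy => by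
      have hxA : x ∈ A := by
        rcases Finset.mem_insert.1 hx with rfl | h
        · exact h0A
        · rcases Finset.mem_union.1 h with h | h
          exacts [hS₀A h, hQA h]
      simpa only [if_pos hxA] using hnoise x y hxy hy
    have h2 : ((insert 0 (S₀ ∪ Q)).card : ℝ) ≤ 2 * m + 1 := by
      have := Finset.card_insert_le 0 (S₀ ∪ Q)
      have := Finset.card_union_le S₀ Q
      exact_mod_cast (by omega : (insert 0 (S₀ ∪ Q)).card ≤ 2 * m + 1)
    have h3 := mul_le_mul_of_nonneg_right h2 hs
    have h4 := sum_sq_stepSignal_sub_le hK (c := τ) (c' := c) (ρ := ρ)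
      (fun j => ⟨(hc j).1, (hc j).2⟩) (Finset.Ioc 0 n)
    linarith
  have hnear : ∀ j, ∃ p ∈ S, τ j ≤ p + r ∧ p ≤ τ j + r := by
    intro j
    by_contra! hcon
    have h1 := hS.jump_le hS₀B hcost le_rfl hs hst htβ hnoise hQ hf h0A hQA
      ((hQmem _).2 ⟨j, rfl⟩) hr (by have := hlo j; omega) (hhi j)
      (hwin j _ (by omega) (by omega)) (hwin j _ (by omega) (by omega))
      (fun x hx => by have := hcon x hx; omega) fun x hx hne => by
        obtain ⟨i, rfl⟩ := (hQmem x).1 hx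
        rcases lt_trichotomy i j with h | h | h
        · have := hsep i j h; omega
        · exact absurd (congrArg τ h) hne
        · have := hsep j i h; omega
    rw [stepSignal_jump hτmono, hQcard, hS₀card] at h1
    have h2 : 0 ≤ ((S ∩ A).card : ℝ) * (β - s) :=
      mul_nonneg (Nat.cast_nonneg _) (by linarith)
    have := hjump j
    linarith
  choose p hpS hp using hnear
  have hpmono : StrictMono p := fun i j hij => by
    have := hsep i j hij; have := hp i; have := hp j; omega
  have hin : m ≤ (S ∩ A).card := by
    have : (Finset.univ.image p).card = m := by
      rw [Finset.card_image_of_injective _ hpmono.injective, Finset.card_univ, Fintype.card_fin]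
    rw [← this]
    refine Finset.card_le_card fun x hx => ?_
    obtain ⟨j, -, rfl⟩ := Finset.mem_image.1 hx
    exact Finset.mem_inter.2 ⟨hpS j, hwin j _ (hp j).1 (hp j).2⟩
  have hcardS := Finset.card_sdiff_add_card_inter S A
  refine recovers_of_near hrr' ?_ hpS hpmono hp
  by_contra hne
  have hgt : m + 1 ≤ (S \ A).card + (S ∩ A).card := by omega
  have h1 := hS.card_le hS₀B hcost hn le_rfl hs hst hnoise hQ hf h0A hQA
  rw [hQcard, hS₀card] at h1
  obtain ⟨k, hk⟩ := Nat.exists_eq_add_of_le hin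
  rw [hk] at h1 hgt
  have hgt' : (1 : ℝ) ≤ (S \ A).card + k := by
    exact_mod_cast (by omega : 1 ≤ (S \ A).card + k)
  push_cast at h1
  have hβt : 0 ≤ β - t := by linarith
  have h2 : (k : ℝ) * (β - t) ≤ k * (β - s) :=
    mul_le_mul_of_nonneg_left (by linarith) (Nat.cast_nonneg _)
  have h3 := mul_le_mul_of_nonneg_right hgt' hβt
  linarith

/-! ### Blocks -/

/-- Every `τ` away from the ends of `{1, …, n}` lies well inside one of the blocks. -/
lemma exists_block {n L V r τ : ℕ} (hL : 1 ≤ L) (hrV : r < V) (hlo : r < τ) (hhi : τ + r < n) :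
    ∃ i ∈ Finset.Icc 1 L, blockLo n L V i - 1 + r < τ ∧ τ + r < blockHi n L V i ∧
      blockHi n L V i ≤ n ∧ blockHi n L V i ≤ blockLo n L V i + (n / L + L + 2 * V) := by
  set q := n / L with hq
  have hdm : q * L + n % L = n := by rw [mul_comm]; exact Nat.div_add_mod n L
  have hmod : n % L < L := Nat.mod_lt _ hL
  obtain ⟨L', rfl⟩ : ∃ L', L = L' + 1 := ⟨L - 1, by omega⟩
  by_cases h : τ < L' * q
  · have hq0 : 0 < q := Nat.pos_of_ne_zero fun h0 => by simp [h0] at h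
    have h1 : τ / q < L' := (Nat.div_lt_iff_lt_mul hq0).2 h
    have h2 : τ / q * q ≤ τ := Nat.div_mul_le_self τ q
    have h3 : τ < (τ / q + 1) * q := Nat.lt_mul_of_div_lt (Nat.lt_succ_self _) hq0
    rw [add_mul, one_mul] at h3
    refine ⟨τ / q + 1, Finset.mem_Icc.2 ⟨Nat.succ_pos _, Nat.succ_le_succ h1.le⟩, ?_⟩
    unfold blockLo blockHi
    rw [if_neg fun h => h1.ne (Nat.succ_injective h), ← hq, Nat.add_sub_cancel, add_mul, one_mul]
    generalize τ / q * q = z at *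
    clear_value q
    omega
  · refine ⟨L' + 1, Finset.mem_Icc.2 (by omega), ?_⟩
    unfold blockLo blockHi
    rw [if_pos rfl, ← hq, Nat.add_sub_cancel]
    rw [mul_add, mul_one, mul_comm] at hdm
    generalize L' * q = z at *
    omega

lemma one_le_blockLo (n L V i : ℕ) : 1 ≤ blockLo n L V i := le_max_left _ _

/-- The Chunk procedure recovers the true changepoints as soon as the noise is small in the sense
of `NoiseBound` and each true changepoint `τ j` lies well inside some block, the `I j`-th, which
contains no other true changepoint. -/
lemma IsChunk.recovers {m n L V : ℕ} {τ : Fin m → ℕ} {μ : Fin (m + 1) → ℝ} {e : ℕ → ℝ}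
    {A S : Finset ℕ} {s t β K D : ℝ} {ρ r r' : ℕ} {I : Fin m → ℕ}
    (hS : IsChunk (fun i => stepSignal τ μ i + e i) β n L V S)
    (hs : 0 ≤ s) (hst : s ≤ t) (htβ : t ≤ β) (hnoise : NoiseBound A s t n e)
    (hK : ∀ i j, (μ i - μ j) ^ 2 ≤ K) (hD : ∀ k : Fin m, D ≤ (μ k.succ - μ k.castSucc) ^ 2)
    (hρ : 0 < ρ) (hρr : ρ ≤ r) (hrr' : r ≤ r')
    (hn : 0 < n) (hsep : ∀ i j, i < j → τ i + (2 * r + (n / L + L + 2 * V)) < τ j)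
    (hlo : ∀ j, r < τ j) (hhi : ∀ j, τ j + r < n)
    (hI : ∀ j, I j ∈ Finset.Icc 1 L ∧ blockLo n L V (I j) - 1 + r < τ j ∧
      τ j + r < blockHi n L V (I j) ∧ blockHi n L V (I j) ≤ n ∧
      blockHi n L V (I j) ≤ blockLo n L V (I j) + (n / L + L + 2 * V))
    (h0A : 0 ∈ A) (hA : ∀ j, Finset.Icc (τ j - r) (τ j + r) ⊆ A)
    (hIA : ∀ j, blockLo n L V (I j) - 1 ∈ A)
    (hr_large : (m + 1) * β + (3 * m + 6) * s + 2 * (m * ρ * K) < r * D / 4)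
    (hρ_large : 7 * s < ρ * D / 4)
    (hcount : (4 * m + 2) * s + 2 * (m * ρ * K) < β - t) :
    Recovers τ r' S := by
  have hsep' : ∀ i j, i < j → τ i + 2 * r < τ j := fun i j hij =>
    (Nat.add_le_add_left (Nat.le_add_right _ _) _).trans_lt (hsep i j hij)
  have hτmono : StrictMono τ := fun i j hij => by have := hsep' i j hij; omega
  have hK0 : 0 ≤ K := (sq_nonneg _).trans (hK 0 0)
  have hm0 : (0 : ℝ) ≤ m := Nat.cast_nonneg _
  have hmK : 0 ≤ (m : ℝ) * ρ * K := by positivity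
  have hβ : 0 ≤ β := by linarith
  obtain ⟨T, hT, hS⟩ := hS
  have hrD : ∀ k : Fin m, (r : ℝ) * D / 4 ≤ r * (μ k.succ - μ k.castSucc) ^ 2 / 4 := fun k => by
    have := hD k
    gcongr
  refine hS.recovers hs hst htβ hnoise hK (hρ.trans_le hρr) hρr hrr' hn
    hsep' hlo hhi h0A hA (fun j => ?_)
    (fun k => by have := hrD k; linarith) hcount
  obtain ⟨hIL, hj1, hj2, hj3, hj4⟩ := hI j
  have hone := one_le_blockLo n L V (I j)
  have hTj := hT (I j) hIL
  have hlo_eq : blockLo n L V (I j) = (blockLo n L V (I j) - 1) + 1 := by omega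
  generalize hb : blockHi n L V (I j) = b at *
  generalize ha : blockLo n L V (I j) - 1 = a at *
  generalize n / L = q at *
  rw [hlo_eq] at hTj
  obtain ⟨c, hcT, hc⟩ := hTj.exists_near hj3 hs hst htβ hnoise (τ := τ j) (ρ := ρ) (r := r)
    (constOff_stepSignal μ fun i => by
      rcases lt_trichotomy i j with h | h | h
      · have := hsep i j h; omega
      · exact Or.inl (by simp [h])
      · have := hsep j i h; omega)
    (by rw [← ha]; exact hIA j) (hA j) hj1 hj2 hρ hρr
    (by
      rw [stepSignal_jump hτmono]
      have := hrD j
      have h1 : 0 ≤ (m : ℝ) * β := by positivity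
      have h2 : 0 ≤ (m : ℝ) * s := by positivity
      linarith)
    (by
      rw [stepSignal_jump hτmono]
      have : (ρ : ℝ) * D / 4 ≤ ρ * (μ j.succ - μ j.castSucc) ^ 2 / 4 := by
        have := hD j
        gcongr
      linarith)
  exact ⟨c, Finset.mem_biUnion.2 ⟨I j, hIL, hcT⟩, hc⟩

/-! ### Asymptotics -/

lemma eventually_mul_log_rpow_le {p q : ℝ} (hpq : p < q) (C : ℝ) :
    ∀ᶠ n : ℕ in atTop, C * Real.log n ^ p ≤ Real.log n ^ q := by
  have hlog : Tendsto (fun n : ℕ => Real.log n) atTop atTop :=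
    Real.tendsto_log_atTop.comp tendsto_natCast_atTop_atTop
  filter_upwards [((tendsto_rpow_atTop (sub_pos.2 hpq)).comp hlog).eventually_ge_atTop C,
    hlog.eventually_gt_atTop 0] with n h1 h2
  have h3 : Real.log n ^ q = Real.log n ^ (q - p) * Real.log n ^ p := by
    rw [← Real.rpow_add h2]; congr 1; ring
  rw [h3]
  exact mul_le_mul_of_nonneg_right h1 (Real.rpow_nonneg h2.le _)

lemma eventually_log_rpow_le_rpow (p : ℝ) {q : ℝ} (hq : 0 < q) :
    ∀ᶠ n : ℕ in atTop, Real.log n ^ p ≤ (n : ℝ) ^ q := by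
  filter_upwards [((isLittleO_log_rpow_rpow_atTop p hq).comp_tendsto
    (tendsto_natCast_atTop_atTop (R := ℝ))).bound one_pos] with n hn
  have h1 : 0 ≤ Real.log n ^ p := Real.rpow_nonneg (Real.log_natCast_nonneg n) _
  have h2 : 0 ≤ (n : ℝ) ^ q := Real.rpow_nonneg (Nat.cast_nonneg n) _
  simpa [Function.comp_def, abs_of_nonneg h1, abs_of_nonneg h2] using hn

lemma isLittleO_ceil_log_rpow (p : ℝ) :
    (fun n : ℕ => ((⌈Real.log n ^ p⌉₊ : ℕ) : ℝ)) =o[atTop] (fun n : ℕ => (n : ℝ)) := by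
  have h1 : (fun n : ℕ => Real.log n ^ p + 1) =o[atTop] (fun n : ℕ => (n : ℝ)) := by
    have h2 := (isLittleO_log_rpow_rpow_atTop p one_pos).comp_tendsto
      (tendsto_natCast_atTop_atTop (R := ℝ))
    simp only [Function.comp_def, Real.rpow_one] at h2
    refine h2.add (isLittleO_const_left.2 (Or.inr ?_))
    simpa [Function.comp_def] using tendsto_natCast_atTop_atTop (R := ℝ)
  refine IsBigO.trans_isLittleO (IsBigO.of_bound 1 (Eventually.of_forall fun n => ?_)) h1
  have h2 : 0 ≤ Real.log n ^ p := Real.rpow_nonneg (Real.log_natCast_nonneg n) _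
  rw [Real.norm_of_nonneg (Nat.cast_nonneg _), Real.norm_of_nonneg (by linarith), one_mul]
  exact (Nat.ceil_lt_add_one h2).le

lemma isLittleO_natDiv {L : ℕ → ℕ} (hL : Tendsto L atTop atTop) :
    (fun n : ℕ => ((n / L n : ℕ) : ℝ)) =o[atTop] (fun n : ℕ => (n : ℝ)) := by
  refine IsLittleO.of_bound fun c hc => ?_
  filter_upwards [(tendsto_natCast_atTop_atTop.comp hL).eventually_ge_atTop (1 / c)] with n hn
  rw [Real.norm_of_nonneg (Nat.cast_nonneg _), Real.norm_of_nonneg (Nat.cast_nonneg _)]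
  have hL0 : (0 : ℝ) < L n := (one_div_pos.2 hc).trans_le hn
  refine Nat.cast_div_le.trans ?_
  rw [div_le_iff₀ hL0]
  have h1 : 1 ≤ c * L n := by
    have : (1 / c) ≤ (L n : ℝ) := hn
    rw [div_le_iff₀ hc] at this
    linarith
  have : (0 : ℝ) ≤ n := Nat.cast_nonneg n
  nlinarith

lemma eventually_floor_add_lt_floor {c d : ℝ} (hc : 0 ≤ c) (hcd : c < d) {s : ℕ → ℕ}
    (hs : (fun n => (s n : ℝ)) =o[atTop] (fun n : ℕ => (n : ℝ))) :
    ∀ᶠ n : ℕ in atTop, ⌊c * n⌋₊ + s n < ⌊d * n⌋₊ := by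
  have hpos : 0 < (d - c) / 2 := by linarith
  filter_upwards [hs.bound hpos, ((tendsto_natCast_atTop_atTop (R := ℝ)).const_mul_atTop
    hpos).eventually_gt_atTop 1] with n h1 h2
  rw [Real.norm_of_nonneg (Nat.cast_nonneg _), Real.norm_of_nonneg (Nat.cast_nonneg _)] at h1
  have h3 := Nat.floor_le (mul_nonneg hc (Nat.cast_nonneg n))
  have h4 := Nat.lt_floor_add_one (d * n)
  have : ((⌊c * n⌋₊ + s n : ℕ) : ℝ) < ⌊d * n⌋₊ := by
    push_cast
    linarith
  exact_mod_cast this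

lemma eventually_trueChange_separated {m : ℕ} {θ : Fin m → ℝ} (hθ_mono : StrictMono θ)
    (hθ : ∀ j, θ j ∈ Set.Ioo (0 : ℝ) 1) {s : ℕ → ℕ}
    (hs : (fun n => (s n : ℝ)) =o[atTop] (fun n : ℕ => (n : ℝ))) :
    ∀ᶠ n : ℕ in atTop, (∀ i j, i < j → trueChange θ n i + s n < trueChange θ n j) ∧
      (∀ j, s n < trueChange θ n j) ∧ ∀ j, trueChange θ n j + s n < n := by
  refine Eventually.and ?_ (Eventually.and ?_ ?_)
  · refine eventually_all.2 fun i => eventually_all.2 fun j => ?_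
    by_cases h : i < j
    · filter_upwards [eventually_floor_add_lt_floor (hθ i).1.le (hθ_mono h) hs] with n hn _
      exact hn
    · exact Eventually.of_forall fun n h' => absurd h' h
  · refine eventually_all.2 fun j => ?_
    filter_upwards [eventually_floor_add_lt_floor le_rfl (hθ j).1 hs] with n hn
    simpa [trueChange] using hn
  · refine eventually_all.2 fun j => ?_
    filter_upwards [eventually_floor_add_lt_floor (hθ j).1.le (hθ j).2 hs] with n hn
    simpa [trueChange] using hn

/-- A sequence of sets tends to have full probability if it contains the complements of two
sequences of sets of vanishing probability. Measurability is not needed. -/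
lemma tendsto_measure_one_of_compl_subset {Ω : Type*} [MeasurableSpace Ω] {P : Measure Ω}
    [IsProbabilityMeasure P] {G B₁ B₂ : ℕ → Set Ω}
    (h₁ : Tendsto (fun n => P (B₁ n)) atTop (𝓝 0)) (h₂ : Tendsto (fun n => P (B₂ n)) atTop (𝓝 0))
    (h : ∀ᶠ n in atTop, ∀ ω, ω ∉ B₁ n → ω ∉ B₂ n → ω ∈ G n) :
    Tendsto (fun n => P (G n)) atTop (𝓝 1) := by
  have hlow : Tendsto (fun n => 1 - (P (B₁ n) + P (B₂ n))) atTop (𝓝 1) := by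
    simpa using ENNReal.Tendsto.sub (tendsto_const_nhds (x := (1 : ENNReal))) (h₁.add h₂)
      (Or.inl ENNReal.one_ne_top)
  refine tendsto_of_tendsto_of_tendsto_of_le_of_le' hlow tendsto_const_nhds ?_
    (Eventually.of_forall fun n => prob_le_one)
  filter_upwards [h] with n hn
  rw [tsub_le_iff_right]
  calc (1 : ENNReal) = P Set.univ := measure_univ.symm
    _ ≤ P (G n ∪ (B₁ n ∪ B₂ n)) := measure_mono fun ω _ => by
      by_cases h1 : ω ∈ B₁ n
      · exact Or.inr (Or.inl h1)
      · by_cases h2 : ω ∈ B₂ n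
        · exact Or.inr (Or.inr h2)
        · exact Or.inl (hn ω h1 h2)
    _ ≤ P (G n) + P (B₁ n ∪ B₂ n) := measure_union_le _ _
    _ ≤ P (G n) + (P (B₁ n) + P (B₂ n)) := by gcongr; exact measure_union_le _ _

lemma exists_pos_forall_le_sq_jump {m : ℕ} {μ : Fin (m + 1) → ℝ}
    (hμ : ∀ k : Fin m, μ k.castSucc ≠ μ k.succ) :
    ∃ D > 0, ∀ k : Fin m, D ≤ (μ k.succ - μ k.castSucc) ^ 2 := by
  have h : ∀ᶠ D in 𝓝[>] (0 : ℝ), ∀ k : Fin m, D ≤ (μ k.succ - μ k.castSucc) ^ 2 :=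
    eventually_all.2 fun k => by
      have : 0 < (μ k.succ - μ k.castSucc) ^ 2 := by
        have := sub_ne_zero.2 (hμ k).symm
        positivity
      exact ((eventually_lt_nhds this).filter_mono nhdsWithin_le_nhds).mono fun _ h => h.le
  obtain ⟨D, hD, hpos⟩ := (h.and self_mem_nhdsWithin).exists
  exact ⟨D, hpos, hD⟩

lemma exists_forall_sq_sub_le {m : ℕ} (μ : Fin (m + 1) → ℝ) :
    ∃ K, ∀ i j, (μ i - μ j) ^ 2 ≤ K := by
  obtain ⟨K, hK⟩ := (Set.finite_range fun p : Fin (m + 1) × Fin (m + 1) =>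
    (μ p.1 - μ p.2) ^ 2).bddAbove
  exact ⟨K, fun i j => hK ⟨(i, j), rfl⟩⟩

end Changepoint

open Changepoint in
theorem theorem1
    {Ω : Type*} [MeasurableSpace Ω] (P : Measure Ω) [IsProbabilityMeasure P]
    (m : ℕ) (θ : Fin m → ℝ) (hθ_mono : StrictMono θ) (hθ : ∀ j, θ j ∈ Set.Ioo (0 : ℝ) 1)
    (μ : Fin (m + 1) → ℝ) (hμ : ∀ k : Fin m, μ k.castSucc ≠ μ k.succ)
    (v : ℝ≥0) (hv : 0 < v)
    (Z : ℕ → ℕ → Ω → ℝ)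
    (hZ_law : ∀ n, ∀ i ∈ Set.Icc 1 n, HasLaw (Z n i) (gaussianReal 0 v) P)
    (hZ_indep : ∀ n, iIndepFun (fun i : Set.Icc 1 n => Z n i) P)
    (L V : ℕ → ℕ)
    (hL_top : Tendsto L atTop atTop)
    (hL_little : (fun n => (L n : ℝ)) =o[atTop] (fun n => (n : ℝ)))
    (γ : ℝ) (hγ : 0 < γ)
    (hV_lower : ∀ᶠ n : ℕ in atTop, ⌈Real.log n ^ (1 + γ)⌉₊ ≤ V n)
    (hV_little : (fun n => (V n : ℝ)) =o[atTop] (fun n => (n : ℝ)))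
    (ε : ℝ) (hε : 0 < ε) (α : ℝ) (hα : 0 < α) :
    Tendsto
      (fun n : ℕ => P {ω | ∀ S : Finset ℕ,
        Changepoint.IsChunk (fun i => Changepoint.signal θ μ n i + Z n i ω)
          ((2 + ε) * v * Real.log n) n (L n) (V n) S →
        Changepoint.Recovers (Changepoint.trueChange θ n) ⌈Real.log n ^ (1 + α)⌉₊ S})
      atTop (𝓝 1) := by
  have hv' : (0 : ℝ) < v := by exact_mod_cast hv
  obtain ⟨D, hD0, hD⟩ := exists_pos_forall_le_sq_jump hμ
  obtain ⟨K, hK⟩ := exists_forall_sq_sub_le μ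
  have hK0 : 0 ≤ K := (sq_nonneg _).trans (hK 0 0)
  -- `ρ n` is about `δ' v log n`, and sums of noise that start in `A n` are below `δ v log n`
  obtain ⟨δ', hδ', hδ'ε⟩ := exists_pos_mul_lt (show 0 < ε / 4 by linarith) (4 * (m * K))
  obtain ⟨δ₁, hδ₁, hδ₁ε⟩ := exists_pos_mul_lt (show 0 < ε / 4 by linarith) (4 * m + 2 : ℝ)
  obtain ⟨δ₂, hδ₂, hδ₂D⟩ := exists_pos_mul_lt (show 0 < δ' * D / 4 by positivity) 7
  set δ := min (min δ₁ δ₂) 1 with hδ_def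
  have hδ : 0 < δ := lt_min (lt_min hδ₁ hδ₂) one_pos
  have hδ1 : δ ≤ 1 := min_le_right _ _
  have hδε : (4 * m + 2) * δ < ε / 4 :=
    (mul_le_mul_of_nonneg_left ((min_le_left _ _).trans (min_le_left _ _))
      (by positivity)).trans_lt hδ₁ε
  have hδD : 7 * δ < δ' * D / 4 :=
    (mul_le_mul_of_nonneg_left ((min_le_left _ _).trans (min_le_right _ _))
      (by norm_num)).trans_lt hδ₂D
  set κ := min α γ / 2 with hκ_def
  have hmin : 0 < min α γ := lt_min hα hγ
  have hκ : 0 < κ := by positivity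
  have hκα : κ < α := (half_lt_self hmin).trans_le (min_le_left _ _)
  have hκγ : κ < γ := (half_lt_self hmin).trans_le (min_le_right _ _)
  set r : ℕ → ℕ := fun n => ⌈Real.log n ^ (1 + κ)⌉₊ with hr_def
  set ρ : ℕ → ℕ := fun n => ⌈δ' * (v * Real.log n)⌉₊ with hρ_def
  set τ : ℕ → Fin m → ℕ := fun n => trueChange θ n with hτ_def
  -- a block in which the `j`-th true changepoint is far from both ends
  set good : ℕ → Fin m → ℕ → Prop := fun n j i => i ∈ Finset.Icc 1 (L n) ∧
    blockLo n (L n) (V n) i - 1 + r n < τ n j ∧ τ n j + r n < blockHi n (L n) (V n) i ∧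
    blockHi n (L n) (V n) i ≤ n ∧
    blockHi n (L n) (V n) i ≤ blockLo n (L n) (V n) i + (n / L n + L n + 2 * V n) with hgood
  set I : ℕ → Fin m → ℕ := fun n j => Classical.epsilon (good n j) with hI_def
  set A : ℕ → Finset ℕ := fun n => insert 0 (Finset.univ.biUnion fun j : Fin m =>
    insert (blockLo n (L n) (V n) (I n j) - 1) (Finset.Icc (τ n j - r n) (τ n j + r n))) with hA_def
  have hAcard : ∀ᶠ n in atTop, ((A n).card : ℝ) ≤ (1 + 6 * m) * (n : ℝ) ^ (δ / 4) := by
    filter_upwards [eventually_log_rpow_le_rpow (1 + κ) (show 0 < δ / 4 by positivity),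
      eventually_ge_atTop 1] with n h1 h2
    have h3 : (A n).card ≤ m * (2 * r n + 2) + 1 := by
      refine (Finset.card_insert_le _ _).trans (Nat.succ_le_succ ?_)
      refine (Finset.card_biUnion_le_card_mul _ _ (2 * r n + 2) fun j _ => ?_).trans_eq (by simp)
      refine (Finset.card_insert_le _ _).trans ?_
      rw [Nat.card_Icc]
      omega
    have h4 : (1 : ℝ) ≤ (n : ℝ) ^ (δ / 4) :=
      Real.one_le_rpow (by exact_mod_cast h2) (by positivity)
    have h5 : (r n : ℝ) ≤ (n : ℝ) ^ (δ / 4) + 1 :=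
      (Nat.ceil_lt_add_one (Real.rpow_nonneg (Real.log_natCast_nonneg n) _)).le.trans (by linarith)
    have h6 : ((A n).card : ℝ) ≤ m * (2 * r n + 2) + 1 := by exact_mod_cast h3
    have hm0 : (0 : ℝ) ≤ m := Nat.cast_nonneg m
    calc ((A n).card : ℝ) ≤ m * (2 * r n + 2) + 1 := h6
      _ ≤ m * (6 * (n : ℝ) ^ (δ / 4)) + (n : ℝ) ^ (δ / 4) := by gcongr; linarith
      _ = _ := by ring
  have hbad₁ := tendsto_measure_exists_lt_sq_sum hv hZ_law hZ_indep (u' := 2 + ε / 2) (κ := 1)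
    (C := 1) zero_le_one (by linarith) (X := Finset.range)
    (Eventually.of_forall fun n => by simp)
  have hbad₂ := tendsto_measure_exists_lt_sq_sum hv hZ_law hZ_indep (u' := δ) (κ := δ / 4)
    (by positivity) (by linarith) hAcard
  refine tendsto_measure_one_of_compl_subset hbad₁ hbad₂ ?_
  have hlog : Tendsto (fun n : ℕ => Real.log n) atTop atTop :=
    Real.tendsto_log_atTop.comp tendsto_natCast_atTop_atTop
  have hsmall : (fun n => ((2 * r n + (n / L n + L n + 2 * V n) : ℕ) : ℝ))
      =o[atTop] (fun n : ℕ => (n : ℝ)) := by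
    have := ((isLittleO_ceil_log_rpow (1 + κ)).const_mul_left 2).add
      (((isLittleO_natDiv hL_top).add hL_little).add (hV_little.const_mul_left 2))
    refine this.congr_left fun n => ?_
    push_cast
    rfl
  set C := (m + 1) * (2 + ε) + (3 * m + 6) * δ + 4 * (m * δ' * K) with hC_def
  filter_upwards [eventually_trueChange_separated hθ_mono hθ hsmall, hV_lower,
    hL_top.eventually_ge_atTop 1, eventually_gt_atTop 0, hlog.eventually_ge_atTop 1,
    hlog.eventually_ge_atTop (1 / (δ' * v)),
    eventually_mul_log_rpow_le (show 1 + κ < 1 + γ by linarith) 2,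
    eventually_mul_log_rpow_le (show 1 < 1 + κ by linarith) (2 * δ' * v),
    eventually_mul_log_rpow_le (show 1 < 1 + κ by linarith) (4 * (C + 1) * v / D)]
    with n hsep hVn hLn hn hlog1 hlogδ hγn hρn hCn
  rw [Real.rpow_one] at hρn hCn
  intro ω hω₁ hω₂ S hS
  set l : ℝ := v * Real.log n with hl_def
  have hl : 0 < l := mul_pos hv' (by linarith)
  have hlδ : 1 ≤ δ' * l := by
    rw [div_le_iff₀ (by positivity)] at hlogδ
    rw [hl_def]
    linarith
  have hr1 : (1 : ℝ) ≤ Real.log n ^ (1 + κ) := Real.one_le_rpow hlog1 (by linarith)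
  have hr_ge : Real.log n ^ (1 + κ) ≤ r n := Nat.le_ceil _
  have hρ_ge : δ' * l ≤ ρ n := Nat.le_ceil _
  have hρ_le : (ρ n : ℝ) ≤ 2 * δ' * l :=
    (Nat.ceil_lt_add_one (by positivity)).le.trans (by linarith)
  have hρr : ρ n ≤ r n := by
    have : (ρ n : ℝ) ≤ r n := by
      refine hρ_le.trans (le_trans ?_ hr_ge)
      rw [hl_def]
      linarith
    exact_mod_cast this
  have hrV : r n < V n := by
    have h1 : (r n : ℝ) < Real.log n ^ (1 + κ) + 1 := Nat.ceil_lt_add_one (by linarith)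
    have h2 : Real.log n ^ (1 + γ) ≤ V n := (Nat.le_ceil _).trans (by exact_mod_cast hVn)
    exact_mod_cast (by linarith : (r n : ℝ) < V n)
  have hr_le : r n ≤ 2 * r n + (n / L n + L n + 2 * V n) := by
    generalize n / L n = q
    omega
  have hlo : ∀ j, r n < τ n j := fun j => hr_le.trans_lt (hsep.2.1 j)
  have hhi : ∀ j, τ n j + r n < n := fun j =>
    (Nat.add_le_add_left hr_le _).trans_lt (hsep.2.2 j)
  have hI : ∀ j, good n j (I n j) := fun j => Classical.epsilon_spec <|
    exists_block hLn hrV (hlo j) (hhi j)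
  have hnoise : NoiseBound (A n) (δ * l) ((2 + ε / 2) * l) n (fun i => Z n i ω) := by
    intro x y hxy hyn
    by_contra hcon
    rw [not_le] at hcon
    split_ifs at hcon with h
    · exact hω₂ ⟨x, h, y, hxy, hyn, hcon⟩
    · exact hω₁ ⟨x, Finset.mem_range.2 (by omega), y, hxy, hyn, hcon⟩
  have hmρK : 2 * (m * ρ n * K) ≤ 4 * (m * δ' * K) * l := by
    have hmK : 0 ≤ (m : ℝ) * K := by positivity
    have := mul_le_mul_of_nonneg_left hρ_le hmK
    linarith
  have hrD : (C + 1) * l ≤ r n * D / 4 := by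
    have h1 := hCn.trans hr_ge
    have h2 : 4 * (C + 1) * v / D * Real.log n = 4 * ((C + 1) * l) / D := by rw [hl_def]; ring
    rw [h2, div_le_iff₀ hD0] at h1
    linarith
  have hβ : (2 + ε) * v * Real.log n = (2 + ε) * l := by rw [hl_def]; ring
  rw [hβ] at hS
  refine IsChunk.recovers (A := A n) (s := δ * l) (t := (2 + ε / 2) * l) (K := K) (D := D)
    (ρ := ρ n) (r := r n) (I := I n) hS (by positivity)
    (mul_le_mul_of_nonneg_right (by linarith) hl.le)
    (mul_le_mul_of_nonneg_right (by linarith) hl.le) hnoise hK hD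
    (Nat.ceil_pos.2 (by positivity)) hρr ?_ hn hsep.1 hlo hhi hI
    (Finset.mem_insert_self _ _) (fun j x hx => ?_) (fun j => ?_) ?_ ?_ ?_
  · exact Nat.ceil_le_ceil (Real.rpow_le_rpow_of_exponent_le hlog1 (by linarith))
  · exact Finset.mem_insert_of_mem (Finset.mem_biUnion.2
      ⟨j, Finset.mem_univ _, Finset.mem_insert_of_mem hx⟩)
  · exact Finset.mem_insert_of_mem (Finset.mem_biUnion.2
      ⟨j, Finset.mem_univ _, Finset.mem_insert_self _ _⟩)
  · calc _ ≤ C * l := by rw [hC_def]; linarith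
      _ < (C + 1) * l := by linarith
      _ ≤ _ := hrD
  · calc 7 * (δ * l) = (7 * δ) * l := by ring
      _ < (δ' * D / 4) * l := by gcongr
      _ = (δ' * l) * D / 4 := by ring
      _ ≤ _ := by gcongr
  · have h1 := mul_lt_mul_of_pos_right hδε hl
    have h2 := mul_lt_mul_of_pos_right hδ'ε hl
    linarith
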